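/- Let $(\Omega,\mathcal F,\mathbb P)$ be a probability space, $F,G$ real separable Hilbert spaces, $x\in L^2(\Omega;F)$, $y\in L^2(\Omega;G)$ and $r\in\mathbb N$. For square-integrable $w,z$, let the uncentered covariance $C_{wz}$ be the bounded operator with $\langle C_{wz}e,f\rangle=\mathbb E[\langle w,f\rangle\langle e,z\rangle]$, so $C_{yx}:F\to G$, and let $C_y:=C_{yy}:G\to G$, with positive self-adjoint square root $C_y^{1/2}$. For a bounded operator $T:\mathcal H\to\mathcal K$ between Hilbert spaces, let $T^\dagger$ be its Moore--Penrose inverse: the linear operator with domain $\operatorname{ran}T\oplus(\operatorname{ran}T)^\perp$ that inverts $T|_{(\ker T)^\perp}$ on $\operatorname{ran}T$ and vanishes on $(\operatorname{ran}T)^\perp$. For compact $T$ with an SVD $T=\sum_{1\le i\le\dim\operatorname{ran}T}\sigma_i\,f_i\otimes e_i$ ($\sigma_i\ge 0$ nonincreasing, $(e_i)$ and $(f_i)$ orthonormal, $(f\otimes e)h=\langle h,e\rangle f$), the operator $\sum_{i\le\min(r,\dim\operatorname{ran}T)}\sigma_i\,f_i\otimes e_i$ is called a rank-$r$ truncated SVD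 of $T$. $P_V$ is the orthogonal projection onto $V$. Consider the problem $$\min\{\mathbb E\|x-Ay\|^2:\ A:G\to F\text{ bounded},\ \operatorname{rank}A\le r\}.\qquad(*)$$ The operator $M:=(C_y^{1/2})^\dagger C_{yx}$ is defined on all of $F$, bounded and compact, and the following hold. 1. $(*)$ has a solution if and only if there is a rank-$r$ truncated SVD $Y$ of $M$ with $\operatorname{ran}Y\subset\operatorname{ran}C_y^{1/2}$. 2. Call a rank-$r$ truncated SVD $Y$ of $P_{\overline{\operatorname{ran}C_y^{1/2}}}M$ admissible if $\operatorname{ran}Y\subset\operatorname{ran}C_y^{1/2}$. For every admissible $Y$, $$\hat A=\big((C_y^{1/2})^\dagger Y\big)^*$$ is a bounded operator that solves $(*)$ and satisfies the minimality property $\hat A P_{(\ker C_y)^\perp}=\hat A$. 3. For $Y$ and $\hat A$ as in 2, $\hat A$ is the only solution of $(*)$ with $\hat A P_{(\ker C_y)^\perp}=\hat A$ if and only if $Y$ is the only admissible truncated SVD. In particular, $\hat A$ is the only such solution if $Y$ is the only rank-$r$ truncated SVD of $P_{\overline{\operatorname{ran}C_y^{1/2}}}M$. -/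

import Mathlib

open MeasureTheory InnerProductSpace
open scoped InnerProductSpace

namespace RankLearning

section Operators

variable {H K L : Type*}
  [NormedAddCommGroup H] [InnerProductSpace ℝ H] [CompleteSpace H]
  [NormedAddCommGroup K] [InnerProductSpace ℝ K]
  [NormedAddCommGroup L] [InnerProductSpace ℝ L]

/-- Every `k ∈ ran T + (ran T)ᗮ` has a unique `h ∈ (ker T)ᗮ` with `k - T h ∈ (ran T)ᗮ`. -/
theorem existsUnique_pinv (T : H →L[ℝ] K) {k : K} (hk : k ∈ T.range ⊔ T.rangeᗮ) :
    ∃! h : H, h ∈ T.kerᗮ ∧ k - T h ∈ T.rangeᗮ := by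
  have : CompleteSpace T.ker := T.isClosed_ker.completeSpace_coe
  obtain ⟨a, ⟨x, rfl⟩, z, hz, rfl⟩ := Submodule.mem_sup.1 hk
  obtain ⟨p, hp, q, hq, rfl⟩ := Submodule.exists_add_mem_mem_orthogonal (K := T.ker) x
  have hp0 : T p = 0 := hp
  refine ⟨q, ⟨hq, ?_⟩, ?_⟩
  · simpa [hp0] using hz
  · rintro h ⟨hh, hh2⟩
    have h1 : T (q - h) ∈ T.rangeᗮ := by
      have : T (q - h) = ((T : H →ₗ[ℝ] K) (p + q) + z - T h) - z := by
        simp only [ContinuousLinearMap.coe_coe, map_add, map_sub, hp0]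
        abel
      rw [this]
      exact Submodule.sub_mem _ hh2 hz
    have h2 : T (q - h) = 0 := by
      have := Submodule.inner_right_of_mem_orthogonal
        (LinearMap.mem_range_self (T : H →ₗ[ℝ] K) (q - h)) h1
      exact inner_self_eq_zero.1 this
    have h3 : q - h ∈ T.ker := h2
    have h4 : q - h ∈ T.kerᗮ := Submodule.sub_mem _ hq hh
    have h5 : ⟪q - h, q - h⟫_ℝ = 0 := Submodule.inner_right_of_mem_orthogonal h3 h4
    exact (sub_eq_zero.1 (inner_self_eq_zero.1 h5)).symm

/-- The Moore--Penrose inverse `T†` of a bounded operator `T : H → K`: the (in general unbounded)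
linear operator with domain `ran T ⊕ (ran T)ᗮ` which inverts `T` restricted to `(ker T)ᗮ` on
`ran T`, and vanishes on `(ran T)ᗮ`. -/
noncomputable def pinv (T : H →L[ℝ] K) : K →ₗ.[ℝ] H where
  domain := T.range ⊔ T.rangeᗮ
  toFun :=
    { toFun := fun k => (existsUnique_pinv T k.2).choose
      map_add' := fun k l => by
        have hk := (existsUnique_pinv T k.2).choose_spec.1
        have hl := (existsUnique_pinv T l.2).choose_spec.1
        refine ((existsUnique_pinv T (k + l).2).choose_spec.2 _ ⟨?_, ?_⟩).symm
        · exact Submodule.add_mem _ hk.1 hl.1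
        · have := Submodule.add_mem _ hk.2 hl.2
          rw [map_add, Submodule.coe_add, add_sub_add_comm]
          exact this
      map_smul' := fun c k => by
        have hk := (existsUnique_pinv T k.2).choose_spec.1
        refine ((existsUnique_pinv T (c • k).2).choose_spec.2 _ ⟨?_, ?_⟩).symm
        · exact Submodule.smul_mem _ _ hk.1
        · have := Submodule.smul_mem _ c hk.2
          rw [RingHom.id_apply, map_smul, Submodule.coe_smul, ← smul_sub]
          exact this }

theorem pinv_spec (T : H →L[ℝ] K) (k : (pinv T).domain) :
    pinv T k ∈ T.kerᗮ ∧ (k : K) - T (pinv T k) ∈ T.rangeᗮ :=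
  (existsUnique_pinv T k.2).choose_spec.1

theorem pinv_eq (T : H →L[ℝ] K) (k : (pinv T).domain) {h : H} (h1 : h ∈ T.kerᗮ)
    (h2 : (k : K) - T h ∈ T.rangeᗮ) : pinv T k = h :=
  ((existsUnique_pinv T k.2).choose_spec.2 h ⟨h1, h2⟩).symm

/-- `T†` inverts `T` restricted to `(ker T)ᗮ`. -/
theorem pinv_apply_of_mem_ker_orthogonal (T : H →L[ℝ] K) (k : (pinv T).domain) {h : H}
    (h1 : h ∈ T.kerᗮ) (hk : (k : K) = T h) : pinv T k = h :=
  pinv_eq T k h1 (by simp [hk])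

/-- `T†` vanishes on `(ran T)ᗮ`. -/
theorem pinv_apply_of_mem_range_orthogonal (T : H →L[ℝ] K) (k : (pinv T).domain)
    (hk : (k : K) ∈ T.rangeᗮ) : pinv T k = 0 :=
  pinv_eq T k (Submodule.zero_mem _) (by simpa using hk)

/-- The composition `S T` of a partially defined operator `S` with a bounded operator `T`,
on its natural domain `T⁻¹ (dom S)`. -/
def compCLM (S : K →ₗ.[ℝ] H) (T : L →L[ℝ] K) : L →ₗ.[ℝ] H where
  domain := S.domain.comap (T : L →ₗ[ℝ] K)
  toFun :=
    { toFun := fun v => S ⟨T v, v.2⟩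
      map_add' := fun v w => by
        rw [← LinearPMap.map_add]; congr 1; ext; simp
      map_smul' := fun c v => by
        rw [RingHom.id_apply, ← LinearPMap.map_smul]; congr 1; ext; simp }

open scoped Classical in
/-- The square root `T^{1/2}` of a positive self-adjoint bounded operator: the unique positive
self-adjoint operator whose square is `T`. (It is `0` if there is none, i.e. if `T` is not positive
self-adjoint.) -/
noncomputable def posSqrt (T : H →L[ℝ] H) : H →L[ℝ] H :=
  if h : ∃ S : H →L[ℝ] H, S.IsPositive ∧ S ∘L S = T then h.choose else 0

/-- The set of bounded operators of rank at most `r`. -/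
def rankLE (r : ℕ) : Set (L →L[ℝ] K) :=
  {A | (A : L →ₗ[ℝ] K).rank ≤ (r : Cardinal)}

/-- The zero-based index set `{i : i < dim ran T}` of an SVD of `T`. -/
def svdIndex (T : L →L[ℝ] K) : Set ℕ :=
  {i | (i : Cardinal) < (T : L →ₗ[ℝ] K).rank}

/-- `T = ∑ i, σ i • f i ⊗ e i` is an SVD of the compact operator `T`: the sum is over `i < dim ran T`
(all `i` if `T` has infinite rank), `σ` is nonnegative and nonincreasing, and `(e i)` and `(f i)` are
orthonormal systems. Values of `σ`, `e`, `f` outside the index set play no role. -/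
structure IsSVD (T : L →L[ℝ] K) (σ : ℕ → ℝ) (e : ℕ → L) (f : ℕ → K) : Prop where
  nonneg : ∀ i ∈ svdIndex T, 0 ≤ σ i
  antitone : AntitoneOn σ (svdIndex T)
  orthonormal_right : Orthonormal ℝ (fun i : svdIndex T => e i)
  orthonormal_left : Orthonormal ℝ (fun i : svdIndex T => f i)
  hasSum : ∀ h : L, HasSum (fun i : svdIndex T => (σ i * ⟪e i, h⟫_ℝ) • f i) (T h)

open scoped Classical in
/-- `Y` is a rank-`r` truncated SVD `(T)_r` of `T`: the sum of the first `r` terms (all the terms,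
if there are fewer than `r`) of some SVD of `T`. -/
def IsTruncatedSVD (r : ℕ) (T Y : L →L[ℝ] K) : Prop :=
  ∃ (σ : ℕ → ℝ) (e : ℕ → L) (f : ℕ → K), IsSVD T σ e f ∧
    Y = ∑ i ∈ (Finset.range r).filter (· ∈ svdIndex T), σ i • rankOne ℝ (f i) (e i)

end Operators

section Covariance

variable {Ω E₁ E₂ : Type*} [MeasurableSpace Ω]
  [NormedAddCommGroup E₁] [InnerProductSpace ℝ E₁]
  [NormedAddCommGroup E₂] [InnerProductSpace ℝ E₂]

/-- The uncentered covariance `C_{wz} = 𝔼[w ⊗ z] : E₁ → E₂` of `w` and `z`. -/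
noncomputable def crossCov (P : Measure Ω) (w : Ω → E₂) (z : Ω → E₁) : E₁ →L[ℝ] E₂ :=
  ∫ ω, rankOne ℝ (w ω) (z ω) ∂P

theorem integrable_rankOne {P : Measure Ω} {w : Ω → E₂} {z : Ω → E₁}
    (hw : MemLp w 2 P) (hz : MemLp z 2 P) :
    Integrable (fun ω => rankOne ℝ (w ω) (z ω)) P := by
  have hm : AEStronglyMeasurable (fun ω => rankOne ℝ (w ω) (z ω)) P := by
    let g : E₂ × E₁ → E₁ →L[ℝ] E₂ := fun p => rankOne ℝ p.1 p.2
    have hc : Continuous g :=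
      ((rankOne ℝ : E₂ →L[ℝ] E₁ →L⋆[ℝ] E₁ →L[ℝ] E₂).continuous.comp continuous_fst).clm_apply
        continuous_snd
    have hm2 : AEStronglyMeasurable (fun ω => g (w ω, z ω)) P :=
      hc.comp_aestronglyMeasurable (hw.aestronglyMeasurable.prodMk hz.aestronglyMeasurable)
    exact hm2
  have hn : Integrable (fun ω => ‖w ω‖ * ‖z ω‖) P :=
    MemLp.integrable_mul (p := 2) (q := 2) hw.norm hz.norm
  exact hn.mono' hm (Filter.Eventually.of_forall fun ω => (norm_rankOne (w ω) (z ω)).le)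

/-- `C_{wz}` is the operator with `⟪C_{wz} e, f⟫ = ∫ ⟪w, f⟫ ⟪e, z⟫ dP`. -/
theorem inner_crossCov [CompleteSpace E₂] {P : Measure Ω} {w : Ω → E₂} {z : Ω → E₁}
    (hw : MemLp w 2 P) (hz : MemLp z 2 P) (e : E₁) (f : E₂) :
    ⟪crossCov P w z e, f⟫_ℝ = ∫ ω, ⟪w ω, f⟫_ℝ * ⟪e, z ω⟫_ℝ ∂P := by
  have hi := integrable_rankOne hw hz
  rw [crossCov, ContinuousLinearMap.integral_apply hi, real_inner_comm,
    ← integral_inner (hi.apply_continuousLinearMap e)]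
  refine integral_congr_ae (Filter.Eventually.of_forall fun ω => ?_)
  simp [inner_smul_right, real_inner_comm, mul_comm]

/-- `A` solves `min {𝔼 ‖x - A y‖² : A bounded, rank A ≤ r}`. -/
def IsSolution (P : Measure Ω) (x : Ω → E₂) (y : Ω → E₁) (r : ℕ) (A : E₁ →L[ℝ] E₂) : Prop :=
  A ∈ rankLE r ∧ IsMinOn (fun B : E₁ →L[ℝ] E₂ => ∫ ω, ‖x ω - B (y ω)‖ ^ 2 ∂P) (rankLE r) A

end Covariance

end RankLearning

namespace RankLearning

/-! Write `S` for the square root of the covariance of `y`. Nonnegativity of the mean squared error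
of scalar linear predictors forces the range of the cross-covariance into that of `S`
(`range_crossCov_le`), so it factors as `S M` with `M` mapping into `(ker S)ᗮ`, and `‖M u‖² ≤ 𝔼⟪u,
x⟫²` makes `M` Hilbert–Schmidt. Completing the square along an orthonormal basis of `F` gives `𝔼‖x -
A y‖² = const + ‖M - S A*‖²` in the Hilbert–Schmidt norm (`integral_norm_sub_sq_eq`).

The problem is thus low-rank approximation of `M` by operators of the form `S A*`. Since `ran S` is
dense in `(ker S)ᗮ`, which contains `ran M`, this constraint does not change the infimum
(`hsSq_sub_le_of_forall_comp_adjoint`). Hence `A` is a solution iff `S A*` is an unconstrained best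
approximation of rank at most `r`. By Eckart–Young (`SVDSystem.hsSq_sub_svdSum_le`) and its converse
(`isTruncatedSVD_of_forall_hsSq_le`), these are exactly the truncated SVDs of `M`.

Finally `S` is injective on `(ker S)ᗮ`, so `A ↦ S A*` is a bijection from minimal solutions to
truncated SVDs with range in `ran S`. Its inverse is `Y ↦ (S† Y)*`, where `S† Y` is bounded by the
closed graph theorem (`exists_clm_eq_pinv_comp`). -/

/-! ### Orthonormal families padded with zeros, and Bessel's inequality. -/

/-- Pairwise orthogonal families all of whose members have norm `0` or `1`. -/
structure PartialOrthonormal {ι E : Type*} [NormedAddCommGroup E] [InnerProductSpace ℝ E]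
    (e : ι → E) : Prop where
  norm_eq : ∀ i, ‖e i‖ = 1 ∨ e i = 0
  inner_eq : ∀ i j, i ≠ j → ⟪e i, e j⟫_ℝ = 0

namespace PartialOrthonormal

variable {ι E : Type*} [NormedAddCommGroup E] [InnerProductSpace ℝ E] {e : ι → E}

theorem norm_le_one (he : PartialOrthonormal e) (i : ι) : ‖e i‖ ≤ 1 := by
  rcases he.norm_eq i with h | h <;> simp [h]

theorem norm_sq_sum (he : PartialOrthonormal e) (s : Finset ι) (a : ι → ℝ) :
    ‖∑ i ∈ s, a i • e i‖ ^ 2 = ∑ i ∈ s, a i ^ 2 * ‖e i‖ ^ 2 := by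
  classical
  rw [← real_inner_self_eq_norm_sq, sum_inner]
  refine Finset.sum_congr rfl fun i hi => ?_
  rw [inner_sum, Finset.sum_eq_single i]
  · rw [inner_smul_left, inner_smul_right, real_inner_self_eq_norm_sq]
    simp only [RCLike.conj_to_real]
    ring
  · intro j _ hj
    rw [inner_smul_left, inner_smul_right, he.inner_eq i j hj.symm]
    simp
  · exact fun h => absurd hi h

theorem inner_sum_smul (he : PartialOrthonormal e) (s : Finset ι) (a : ι → ℝ) {i : ι}
    (hi : i ∈ s) : ⟪e i, ∑ j ∈ s, a j • e j⟫_ℝ = a i * ‖e i‖ ^ 2 := by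
  rw [inner_sum, Finset.sum_eq_single i]
  · rw [inner_smul_right, real_inner_self_eq_norm_sq]
  · intro j _ hj
    rw [inner_smul_right, he.inner_eq i j hj.symm, mul_zero]
  · exact fun h => absurd hi h

theorem sum_inner_sq_le (he : PartialOrthonormal e) (s : Finset ι) (h : E) :
    ∑ i ∈ s, ⟪e i, h⟫_ℝ ^ 2 ≤ ‖h‖ ^ 2 := by
  have h0 : 0 ≤ ‖h - ∑ i ∈ s, ⟪e i, h⟫_ℝ • e i‖ ^ 2 := by positivity
  rw [norm_sub_sq_real, he.norm_sq_sum, inner_sum] at h0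
  have h1 : ∑ i ∈ s, ⟪e i, h⟫_ℝ ^ 2 * ‖e i‖ ^ 2 ≤ ∑ i ∈ s, ⟪e i, h⟫_ℝ ^ 2 :=
    Finset.sum_le_sum fun i _ => mul_le_of_le_one_right (sq_nonneg _)
      (pow_le_one₀ (norm_nonneg _) (he.norm_le_one i))
  have h2 : ∑ i ∈ s, ⟪h, ⟪e i, h⟫_ℝ • e i⟫_ℝ = ∑ i ∈ s, ⟪e i, h⟫_ℝ ^ 2 :=
    Finset.sum_congr rfl fun i _ => by rw [inner_smul_right, real_inner_comm h, sq]
  linarith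

/-- The part of `h` orthogonal to the family. -/
theorem norm_sq_sub_sum (he : PartialOrthonormal e) (s : Finset ι) (h : E) :
    ‖h - ∑ i ∈ s, ⟪e i, h⟫_ℝ • e i‖ ^ 2 = ‖h‖ ^ 2 - ∑ i ∈ s, ⟪e i, h⟫_ℝ ^ 2 := by
  rw [norm_sub_sq_real, he.norm_sq_sum, inner_sum]
  have h1 : ∑ i ∈ s, ⟪e i, h⟫_ℝ ^ 2 * ‖e i‖ ^ 2 = ∑ i ∈ s, ⟪e i, h⟫_ℝ ^ 2 :=
    Finset.sum_congr rfl fun i _ => by rcases he.norm_eq i with h | h <;> simp [h]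
  have h2 : ∑ i ∈ s, ⟪h, ⟪e i, h⟫_ℝ • e i⟫_ℝ = ∑ i ∈ s, ⟪e i, h⟫_ℝ ^ 2 :=
    Finset.sum_congr rfl fun i _ => by rw [inner_smul_right, real_inner_comm h, sq]
  linarith

theorem orthonormal_subtype (he : PartialOrthonormal e) {t : Set ι} (ht : ∀ i ∈ t, e i ≠ 0) :
    Orthonormal ℝ (fun i : t => e i) :=
  ⟨fun i => (he.norm_eq i).resolve_right (ht i i.2),
    fun _ _ hij => he.inner_eq _ _ fun h => hij (Subtype.ext h)⟩

theorem norm_sum_smul_inner_le {K : Type*} [NormedAddCommGroup K] [InnerProductSpace ℝ K]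
    {f : ι → K} (he : PartialOrthonormal e) (hf : PartialOrthonormal f) (s : Finset ι) {c : ι → ℝ}
    {C : ℝ} (hC : 0 ≤ C) (hc : ∀ i ∈ s, |c i| ≤ C) (h : E) :
    ‖∑ i ∈ s, (c i * ⟪e i, h⟫_ℝ) • f i‖ ≤ C * ‖h‖ := by
  refine le_of_sq_le_sq ?_ (by positivity)
  rw [hf.norm_sq_sum, mul_pow]
  calc ∑ i ∈ s, (c i * ⟪e i, h⟫_ℝ) ^ 2 * ‖f i‖ ^ 2 ≤ ∑ i ∈ s, C ^ 2 * ⟪e i, h⟫_ℝ ^ 2 := by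
        refine Finset.sum_le_sum fun i hi => ?_
        have h1 : c i ^ 2 ≤ C ^ 2 := sq_le_sq' (abs_le.1 (hc i hi)).1 (abs_le.1 (hc i hi)).2
        calc (c i * ⟪e i, h⟫_ℝ) ^ 2 * ‖f i‖ ^ 2 ≤ (c i * ⟪e i, h⟫_ℝ) ^ 2 :=
              mul_le_of_le_one_right (sq_nonneg _)
                (pow_le_one₀ (norm_nonneg _) (hf.norm_le_one i))
          _ ≤ _ := by rw [mul_pow]; gcongr
    _ ≤ C ^ 2 * ‖h‖ ^ 2 := by
        rw [← Finset.mul_sum]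
        exact mul_le_mul_of_nonneg_left (he.sum_inner_sq_le s h) (sq_nonneg _)

end PartialOrthonormal

/-! ### Singular value decomposition of compact operators. -/

section

variable {F G : Type*}
  [NormedAddCommGroup F] [InnerProductSpace ℝ F] [CompleteSpace F]
  [NormedAddCommGroup G] [InnerProductSpace ℝ G] [CompleteSpace G]

/-- A compact operator attains its norm, at a pair of singular vectors. -/
theorem exists_top_singular_pair {T : F →L[ℝ] G} (hT : IsCompactOperator T) :
    ∃ (v : F) (u : G), T v = ‖T‖ • u ∧ T.adjoint u = ‖T‖ • v ∧
      (0 < ‖T‖ → ‖v‖ = 1 ∧ ‖u‖ = 1) ∧ (‖T‖ = 0 → v = 0 ∧ u = 0) := by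
  rcases (norm_nonneg T).eq_or_lt with h0 | h0
  · exact ⟨0, 0, by simp, by simp, fun h => absurd h (by simp [← h0]), fun _ => ⟨rfl, rfl⟩⟩
  set t := ‖T‖ with ht
  have h1 : ∀ n : ℕ, ∃ v : F, ‖v‖ ≤ 1 ∧ t - 1 / (n + 1) < ‖T v‖ := fun n => by
    have hlt : t - 1 / ((n : ℝ) + 1) < ‖T‖ := by
      have : (0 : ℝ) < 1 / ((n : ℝ) + 1) := by positivity
      linarith
    obtain ⟨v, hv, hv'⟩ := T.exists_lt_apply_of_lt_opNorm hlt
    exact ⟨v, hv.le, hv'⟩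
  choose v hv hTv using h1
  have hTv' : ∀ n, ‖T (v n)‖ ≤ t := fun n => T.unit_le_opNorm _ (hv n)
  have hlim : Filter.Tendsto (fun n => ‖T (v n)‖) Filter.atTop (nhds t) := by
    refine tendsto_of_tendsto_of_tendsto_of_le_of_le (g := fun n : ℕ => t - 1 / ((n : ℝ) + 1))
      ?_ tendsto_const_nhds (fun n => (hTv n).le) hTv'
    simpa using tendsto_const_nhds.sub (tendsto_one_div_add_atTop_nhds_zero_nat (𝕜 := ℝ))
  have hK : IsCompact (closure (T '' Metric.closedBall 0 1)) :=
    IsCompactOperator.isCompact_closure_image_closedBall (f := (T : F →ₗ[ℝ] G)) hT 1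
  obtain ⟨w, -, φ, hφ, hw⟩ := hK.tendsto_subseq (x := fun n => T (v n)) fun n =>
    subset_closure ⟨v n, by simpa using hv n, rfl⟩
  have hlimφ := hlim.comp hφ.tendsto_atTop
  have hwn : ‖w‖ = t := tendsto_nhds_unique hw.norm hlimφ
  have hadj : Filter.Tendsto (fun n => T.adjoint (T (v (φ n)))) Filter.atTop
      (nhds (T.adjoint w)) := (T.adjoint.continuous.tendsto w).comp hw
  -- A maximizing sequence consists of approximate eigenvectors of `T* T`: for `‖v‖ ≤ 1`, `‖T* T v -
  -- t² v‖² ≤ 2 t² (t² - ‖T v‖²)`. Since `T* T v` converges along the subsequence, so does `v`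
  -- itself, and no weak compactness is needed.
  have hdiff : Filter.Tendsto (fun n => T.adjoint (T (v (φ n))) - t ^ 2 • v (φ n)) Filter.atTop
      (nhds 0) := by
    rw [tendsto_zero_iff_norm_tendsto_zero]
    have hsq : Filter.Tendsto (fun n => Real.sqrt (2 * t ^ 2 * (t ^ 2 - ‖T (v (φ n))‖ ^ 2)))
        Filter.atTop (nhds 0) := by
      have := ((tendsto_const_nhds (x := t ^ 2)).sub (hlimφ.pow 2)).const_mul (2 * t ^ 2)
      simpa using this.sqrt
    refine squeeze_zero (fun _ => norm_nonneg _) (fun n => ?_) hsq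
    refine Real.le_sqrt_of_sq_le ?_
    rw [norm_sub_sq_real, inner_smul_right, ContinuousLinearMap.adjoint_inner_left,
      real_inner_self_eq_norm_sq, norm_smul, mul_pow]
    have a1 : ‖T.adjoint (T (v (φ n)))‖ ≤ t * t := by
      refine (T.adjoint.le_opNorm _).trans ?_
      rw [LinearIsometryEquiv.norm_map]
      exact mul_le_mul_of_nonneg_left (hTv' _) h0.le
    have a2 : ‖T.adjoint (T (v (φ n)))‖ ^ 2 ≤ (t * t) ^ 2 := pow_le_pow_left₀ (norm_nonneg _) a1 2
    have a3 : ‖v (φ n)‖ ^ 2 ≤ 1 := pow_le_one₀ (norm_nonneg _) (hv _)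
    have a4 : ‖t ^ 2‖ ^ 2 * ‖v (φ n)‖ ^ 2 ≤ ‖t ^ 2‖ ^ 2 :=
      mul_le_of_le_one_right (sq_nonneg _) a3
    rw [Real.norm_of_nonneg (sq_nonneg t)] at a4 ⊢
    nlinarith
  have hvlim : Filter.Tendsto (fun n => v (φ n)) Filter.atTop
      (nhds ((t ^ 2)⁻¹ • T.adjoint w)) := by
    have := (hadj.sub hdiff).const_smul (t ^ 2)⁻¹
    simp only [sub_sub_cancel, sub_zero] at this
    simpa [smul_smul, inv_mul_cancel₀ (pow_ne_zero 2 h0.ne')] using this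
  set v' := (t ^ 2)⁻¹ • T.adjoint w with hv'
  have hTv'w : T v' = w := tendsto_nhds_unique ((T.continuous.tendsto _).comp hvlim) hw
  have hv1 : ‖v'‖ ≤ 1 := le_of_tendsto' hvlim.norm fun n => hv _
  have hv2 : 1 ≤ ‖v'‖ := by
    have := T.le_opNorm v'
    rw [hTv'w, hwn] at this
    exact le_of_mul_le_mul_left (by simpa using this) h0
  refine ⟨v', t⁻¹ • w, ?_, ?_, fun _ => ⟨le_antisymm hv1 hv2, ?_⟩, fun h => absurd h h0.ne'⟩
  · rw [hTv'w, smul_smul, mul_inv_cancel₀ h0.ne', one_smul]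
  · rw [map_smul, hv', smul_smul]
    congr 1
    field_simp
  · rw [norm_smul, hwn, norm_inv, Real.norm_of_nonneg h0.le, inv_mul_cancel₀ h0.ne']

/-- A singular value decomposition `T = ∑ i, σ i • f i ⊗ e i` indexed by all of `ℕ`, in which the
singular vectors belonging to vanishing singular values are zero. -/
structure SVDSystem (T : F →L[ℝ] G) (σ : ℕ → ℝ) (e : ℕ → F) (f : ℕ → G) : Prop where
  nonneg : ∀ i, 0 ≤ σ i
  antitone : Antitone σ
  right : PartialOrthonormal e
  left : PartialOrthonormal f
  right_ne : ∀ i, 0 < σ i → e i ≠ 0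
  left_ne : ∀ i, 0 < σ i → f i ≠ 0
  eq_zero : ∀ i, σ i = 0 → e i = 0 ∧ f i = 0
  hasSum : ∀ h : F, HasSum (fun i => (σ i * ⟪e i, h⟫_ℝ) • f i) (T h)

/-- The sequence of operators that arises by repeatedly splitting off the top singular pair. -/
theorem exists_deflation {T : F →L[ℝ] G} (hT : IsCompactOperator T) :
    ∃ (R : ℕ → F →L[ℝ] G) (e : ℕ → F) (f : ℕ → G), R 0 = T ∧
      (∀ n, R (n + 1) = R n - ‖R n‖ • rankOne ℝ (f n) (e n)) ∧
      ∀ n, R n (e n) = ‖R n‖ • f n ∧ (R n).adjoint (f n) = ‖R n‖ • e n ∧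
        (0 < ‖R n‖ → ‖e n‖ = 1 ∧ ‖f n‖ = 1) ∧ (‖R n‖ = 0 → e n = 0 ∧ f n = 0) := by
  choose v u h1 using fun A : {A : F →L[ℝ] G // IsCompactOperator A} =>
    exists_top_singular_pair A.2
  let step : {A : F →L[ℝ] G // IsCompactOperator A} → {A : F →L[ℝ] G // IsCompactOperator A} :=
    fun A => ⟨A.1 - ‖A.1‖ • rankOne ℝ (u A) (v A), by
      have h2 : IsCompactOperator (A.1 ∘L ContinuousLinearMap.id ℝ F -
          A.1 ∘L rankOne ℝ (v A) (v A)) := by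
        exact (A.2.comp_clm _).sub (A.2.comp_clm (rankOne ℝ (v A) (v A)))
      convert! h2 using 2
      rw [comp_rankOne, (h1 A).1]
      ext; simp [smul_smul, mul_comm]⟩
  let R : ℕ → {A : F →L[ℝ] G // IsCompactOperator A} := fun n => step^[n] ⟨T, hT⟩
  refine ⟨fun n => (R n).1, fun n => v (R n), fun n => u (R n), rfl, fun n => ?_,
    fun n => h1 (R n)⟩
  simp only [R, Function.iterate_succ_apply']
  rfl

/-- The singular values are the norms of the successive residuals. Compactness is what drives them
to zero. -/
theorem exists_svdSystem {T : F →L[ℝ] G} (hT : IsCompactOperator T) :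
    ∃ (σ : ℕ → ℝ) (e : ℕ → F) (f : ℕ → G), SVDSystem T σ e f ∧
      Filter.Tendsto σ Filter.atTop (nhds 0) := by
  obtain ⟨R, e, f, hR0, hR, hRef⟩ := exists_deflation hT
  -- The next residual is the current one precomposed with `h ↦ h - ⟪e n, h⟫ e n`, which is a
  -- contraction.
  have hanti : Antitone fun n => ‖R n‖ := by
    refine antitone_nat_of_succ_le fun n => ?_
    refine ContinuousLinearMap.opNorm_le_bound _ (norm_nonneg _) fun h => ?_
    have h1 : R (n + 1) h = R n (h - ⟪e n, h⟫_ℝ • e n) := by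
      rw [hR, map_sub, map_smul, (hRef n).1]
      simp [smul_smul, mul_comm]
    rw [h1]
    refine ((R n).le_opNorm _).trans (mul_le_mul_of_nonneg_left ?_ (norm_nonneg _))
    refine le_of_sq_le_sq ?_ (norm_nonneg _)
    rw [norm_sub_sq_real, inner_smul_right, norm_smul, real_inner_comm]
    have h2 : ‖e n‖ ≤ 1 := by
      rcases (norm_nonneg (R n)).eq_or_lt with h | h
      · simp [((hRef n).2.2.2 h.symm).1]
      · exact ((hRef n).2.2.1 h).1.le
    have h3 : ‖⟪h, e n⟫_ℝ‖ ^ 2 * ‖e n‖ ^ 2 ≤ ‖⟪h, e n⟫_ℝ‖ ^ 2 :=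
      mul_le_of_le_one_right (sq_nonneg _) (pow_le_one₀ (norm_nonneg _) h2)
    rw [mul_pow]
    simp only [Real.norm_eq_abs, sq_abs] at h3 ⊢
    nlinarith [sq_nonneg (⟪h, e n⟫_ℝ)]
  -- Later residuals annihilate all earlier singular vectors; pairing this with the singular
  -- equations gives the orthogonality of the families.
  have hker : ∀ n k, R (n + 1 + k) (e n) = 0 ∧ (R (n + 1 + k)).adjoint (f n) = 0 := by
    intro n k
    induction k with
    | zero =>
      rw [add_zero, hR]
      rcases (norm_nonneg (R n)).eq_or_lt with h | h
      · simp [((hRef n).2.2.2 h.symm).1, ((hRef n).2.2.2 h.symm).2]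
      · obtain ⟨h1, h2⟩ := (hRef n).2.2.1 h
        constructor
        · simp [(hRef n).1, h1]
        · simp [(hRef n).2.1, h2]
    | succ k ih =>
      set m := n + 1 + k with hm
      have hm' : n + 1 + (k + 1) = m + 1 := by omega
      rw [hm', hR]
      have h1 : ‖R m‖ * ⟪e m, e n⟫_ℝ = 0 := by
        have : ⟪(R m).adjoint (f m), e n⟫_ℝ = 0 := by
          rw [ContinuousLinearMap.adjoint_inner_left, ih.1, inner_zero_right]
        rwa [(hRef m).2.1, real_inner_smul_left] at this
      have h2 : ‖R m‖ * ⟪f m, f n⟫_ℝ = 0 := by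
        have : ⟪R m (e m), f n⟫_ℝ = 0 := by
          rw [← ContinuousLinearMap.adjoint_inner_right, ih.2, inner_zero_right]
        rwa [(hRef m).1, real_inner_smul_left] at this
      constructor
      · simp [ih.1, smul_smul, h1]
      · simp [ih.2, smul_smul, h2]
  have hlt : ∀ n m, n < m → ⟪e m, e n⟫_ℝ = 0 ∧ ⟪f m, f n⟫_ℝ = 0 := by
    intro n m hnm
    obtain ⟨k, rfl⟩ := Nat.exists_eq_add_of_le (Nat.succ_le_of_lt hnm)
    rw [Nat.succ_eq_add_one]
    set m := n + 1 + k with hm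
    rcases (norm_nonneg (R m)).eq_or_lt with h | h
    · simp [((hRef m).2.2.2 h.symm).1, ((hRef m).2.2.2 h.symm).2]
    constructor
    · have : ⟪(R m).adjoint (f m), e n⟫_ℝ = 0 := by
        rw [ContinuousLinearMap.adjoint_inner_left, (hker n k).1, inner_zero_right]
      rw [(hRef m).2.1, real_inner_smul_left] at this
      exact (mul_eq_zero.1 this).resolve_left h.ne'
    · have : ⟪R m (e m), f n⟫_ℝ = 0 := by
        rw [← ContinuousLinearMap.adjoint_inner_right, (hker n k).2, inner_zero_right]
      rw [(hRef m).1, real_inner_smul_left] at this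
      exact (mul_eq_zero.1 this).resolve_left h.ne'
  have he : PartialOrthonormal e := by
    refine ⟨fun n => ?_, fun i j hij => ?_⟩
    · rcases (norm_nonneg (R n)).eq_or_lt with h | h
      · exact Or.inr ((hRef n).2.2.2 h.symm).1
      · exact Or.inl ((hRef n).2.2.1 h).1
    · rcases lt_or_gt_of_ne hij with h | h
      · rw [real_inner_comm]; exact (hlt i j h).1
      · exact (hlt j i h).1
  have hf : PartialOrthonormal f := by
    refine ⟨fun n => ?_, fun i j hij => ?_⟩
    · rcases (norm_nonneg (R n)).eq_or_lt with h | h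
      · exact Or.inr ((hRef n).2.2.2 h.symm).2
      · exact Or.inl ((hRef n).2.2.1 h).2
    · rcases lt_or_gt_of_ne hij with h | h
      · rw [real_inner_comm]; exact (hlt i j h).2
      · exact (hlt j i h).2
  have hpart : ∀ n h, T h = R n h + ∑ i ∈ Finset.range n, (‖R i‖ * ⟪e i, h⟫_ℝ) • f i := by
    intro n h
    induction n with
    | zero => simp [hR0]
    | succ n ih =>
      rw [ih, hR, Finset.sum_range_succ]
      simp only [sub_apply, smul_apply, rankOne_apply,
        smul_smul]
      abel
  have hTe : ∀ n, T (e n) = ‖R n‖ • f n := by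
    intro n
    rw [hpart n, (hRef n).1, Finset.sum_eq_zero, add_zero]
    intro i hi
    rw [he.inner_eq i n (Finset.mem_range.1 hi).ne]
    simp
  have hlim : Filter.Tendsto (fun n => ‖R n‖) Filter.atTop (nhds 0) := by
    have hb : BddBelow (Set.range fun n => ‖R n‖) := ⟨0, by rintro _ ⟨n, rfl⟩; exact norm_nonneg _⟩
    have hl := tendsto_atTop_ciInf hanti hb
    set L := ⨅ n, ‖R n‖
    have hL : ∀ n, L ≤ ‖R n‖ := fun n => ciInf_le hb n
    rcases (Real.iInf_nonneg fun n => norm_nonneg (R n) : 0 ≤ L).eq_or_lt with h0 | h0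
    · exact h0.symm ▸ hl
    exfalso
    have hK : IsCompact (closure (T '' Metric.closedBall 0 1)) :=
      IsCompactOperator.isCompact_closure_image_closedBall (f := (T : F →ₗ[ℝ] G)) hT 1
    obtain ⟨w, -, φ, hφ, hw⟩ := hK.tendsto_subseq (x := fun n => T (e n)) fun n =>
      subset_closure ⟨e n, by simpa using he.norm_le_one n, rfl⟩
    obtain ⟨N, hN⟩ := Metric.cauchySeq_iff'.1 hw.cauchySeq L h0
    have h1 := hN (N + 1) (Nat.le_succ N)
    rw [dist_eq_norm] at h1
    simp only [Function.comp_apply, hTe] at h1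
    have hne : φ (N + 1) ≠ φ N := (hφ (Nat.lt_succ_self N)).ne'
    -- If the residual norms stayed above `L > 0`, the vectors `T (e n) = ‖R n‖ • f n` would be
    -- orthogonal of norm at least `L`, so no subsequence of them could be Cauchy.
    have h2 : L ^ 2 ≤ ‖‖R (φ (N + 1))‖ • f (φ (N + 1)) - ‖R (φ N)‖ • f (φ N)‖ ^ 2 := by
      rw [norm_sub_sq_real, real_inner_smul_left, inner_smul_right, hf.inner_eq _ _ hne,
        norm_smul, norm_smul, ((hRef _).2.2.1 (h0.trans_le (hL _))).2,
        ((hRef _).2.2.1 (h0.trans_le (hL _))).2]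
      have := hL (φ N)
      have h3 : L ^ 2 ≤ ‖R (φ N)‖ ^ 2 := pow_le_pow_left₀ h0.le this 2
      simp only [norm_norm, mul_one, mul_zero, sub_zero]
      nlinarith [sq_nonneg ‖R (φ (N + 1))‖]
    exact absurd (le_of_sq_le_sq h2 (norm_nonneg _)) (not_le.2 h1)
  refine ⟨fun n => ‖R n‖, e, f, ⟨fun n => norm_nonneg _, hanti, he, hf, fun n hn => ?_,
    fun n hn => ?_, fun n hn => (hRef n).2.2.2 hn, fun h => ?_⟩, hlim⟩
  · exact norm_ne_zero_iff.1 (by rw [((hRef n).2.2.1 hn).1]; exact one_ne_zero)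
  · exact norm_ne_zero_iff.1 (by rw [((hRef n).2.2.1 hn).2]; exact one_ne_zero)
  · rw [HasSum, SummationFilter.unconditional_filter, Metric.tendsto_atTop]
    intro ε hε
    -- The factor 2 accounts for two errors of size at most `‖R n‖ ‖h‖`: the residual, and the terms
    -- of `s` beyond index `n`.
    have hl2 : Filter.Tendsto (fun n => 2 * ‖R n‖ * ‖h‖) Filter.atTop (nhds 0) := by
      simpa using (hlim.const_mul 2).mul_const ‖h‖
    obtain ⟨n, hn⟩ := ((tendsto_order.1 hl2).2 ε hε).exists
    refine ⟨Finset.range n, fun s hs => lt_of_le_of_lt ?_ hn⟩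
    rw [dist_eq_norm, ← Finset.sum_sdiff hs, hpart n h]
    have h1 := he.norm_sum_smul_inner_le hf (s \ Finset.range n) (c := fun i => ‖R i‖)
      (norm_nonneg (R n)) (fun i hi => by
        rw [abs_of_nonneg (norm_nonneg _)]
        refine hanti ?_
        simpa using (Finset.mem_sdiff.1 hi).2) h
    calc _ = ‖∑ i ∈ s \ Finset.range n, (‖R i‖ * ⟪e i, h⟫_ℝ) • f i - R n h‖ := by
          congr 1; abel
      _ ≤ ‖R n‖ * ‖h‖ + ‖R n‖ * ‖h‖ := (norm_sub_le _ _).trans (add_le_add h1 ((R n).le_opNorm h))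
      _ = _ := by ring

end

/-! ### Operators of rank at most `r`. -/

section

variable {F G : Type*}
  [NormedAddCommGroup F] [InnerProductSpace ℝ F]
  [NormedAddCommGroup G] [InnerProductSpace ℝ G]

theorem mem_rankLE {r : ℕ} {A : F →L[ℝ] G} :
    A ∈ rankLE (L := F) (K := G) r ↔ (A : F →ₗ[ℝ] G).rank ≤ (r : Cardinal) := Iff.rfl

theorem mem_svdIndex {T : F →L[ℝ] G} {i : ℕ} :
    i ∈ svdIndex T ↔ (i : Cardinal) < (T : F →ₗ[ℝ] G).rank := Iff.rfl

theorem sum_rankOne_mem_rankLE (r : ℕ) (a : ℕ → G) (c : ℕ → F) :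
    ∑ i ∈ Finset.range r, rankOne ℝ (a i) (c i) ∈ rankLE (L := F) (K := G) r := by
  classical
  rw [mem_rankLE]
  have h1 : LinearMap.range ((∑ i ∈ Finset.range r, rankOne ℝ (a i) (c i) : F →L[ℝ] G) :
      F →ₗ[ℝ] G) ≤ Submodule.span ℝ ((Finset.range r).image a : Set G) := by
    rintro _ ⟨h, rfl⟩
    simp only [ContinuousLinearMap.coe_coe, sum_apply, rankOne_apply]
    exact Submodule.sum_mem _ fun i hi =>
      Submodule.smul_mem _ _ (Submodule.subset_span (Finset.mem_image_of_mem a hi))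
  refine (Submodule.rank_mono h1).trans ((rank_span_finset_le _).trans ?_)
  exact_mod_cast Finset.card_image_le.trans (Finset.card_range r).le

theorem finiteDimensional_range_of_mem_rankLE {r : ℕ} {B : F →L[ℝ] G}
    (hB : B ∈ rankLE (L := F) (K := G) r) : FiniteDimensional ℝ B.range :=
  Module.rank_lt_aleph0_iff.1 (lt_of_le_of_lt hB (Cardinal.natCast_lt_aleph0))

theorem isCompactOperator_of_mem_rankLE {r : ℕ} {B : F →L[ℝ] G}
    (hB : B ∈ rankLE (L := F) (K := G) r) : IsCompactOperator B := by
  have := finiteDimensional_range_of_mem_rankLE hB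
  have h1 : IsCompactOperator (id : B.range → B.range) :=
    (isCompactOperator_id_iff_finiteDimensional (𝕜 := ℝ)).2 this
  exact (h1.comp_clm (B.codRestrict B.range fun x => ⟨x, rfl⟩)).clm_comp B.range.subtypeL

end

/-! ### Truncations, and the dictionary between the two forms of an SVD. -/

section

variable {F G : Type*}
  [NormedAddCommGroup F] [InnerProductSpace ℝ F]
  [NormedAddCommGroup G] [InnerProductSpace ℝ G]
  {T : F →L[ℝ] G} {σ : ℕ → ℝ} {e : ℕ → F} {f : ℕ → G}

/-- The sum of the first `r` terms of a singular value decomposition. -/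
noncomputable def svdSum (σ : ℕ → ℝ) (e : ℕ → F) (f : ℕ → G) (r : ℕ) : F →L[ℝ] G :=
  ∑ i ∈ Finset.range r, σ i • rankOne ℝ (f i) (e i)

theorem svdSum_apply (r : ℕ) (h : F) :
    svdSum σ e f r h = ∑ i ∈ Finset.range r, (σ i * ⟪e i, h⟫_ℝ) • f i := by
  simp [svdSum, smul_smul]

theorem svdSum_mem_rankLE (r : ℕ) : svdSum σ e f r ∈ rankLE (L := F) (K := G) r := by
  have := sum_rankOne_mem_rankLE r (fun i => σ i • f i) e
  simpa [svdSum] using this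

namespace SVDSystem

theorem apply_right (h : SVDSystem T σ e f) (i : ℕ) : T (e i) = σ i • f i := by
  refine (h.hasSum (e i)).unique ?_
  convert hasSum_single i ?_ using 1
  · rcases (h.nonneg i).eq_or_lt with h0 | h0
    · simp [← h0]
    · rw [real_inner_self_eq_norm_sq, (h.right.norm_eq i).resolve_right (h.right_ne i h0)]
      simp
  · intro j hj
    rw [h.right.inner_eq j i hj]
    simp

theorem svdSum_apply_right (h : SVDSystem T σ e f) {r i : ℕ} (hi : i < r) :
    svdSum σ e f r (e i) = σ i • f i := by
  rw [svdSum_apply, Finset.sum_eq_single i]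
  · rcases h.right.norm_eq i with h0 | h0
    · rw [real_inner_self_eq_norm_sq, h0]; simp
    · rcases (h.nonneg i).eq_or_lt with h1 | h1
      · simp [← h1]
      · exact absurd h0 (h.right_ne i h1)
  · intro j _ hj
    rw [h.right.inner_eq j i hj]
    simp
  · intro h1
    exact absurd (Finset.mem_range.2 hi) h1

theorem svdSum_apply_left (h : SVDSystem T σ e f) {r i : ℕ} (hi : i < r) :
    svdSum σ f e r (f i) = σ i • e i := by
  rw [svdSum_apply, Finset.sum_eq_single i]
  · rcases h.left.norm_eq i with h0 | h0
    · rw [real_inner_self_eq_norm_sq, h0]; simp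
    · rcases (h.nonneg i).eq_or_lt with h1 | h1
      · simp [← h1]
      · exact absurd h0 (h.left_ne i h1)
  · intro j _ hj
    rw [h.left.inner_eq j i hj]
    simp
  · intro h1
    exact absurd (Finset.mem_range.2 hi) h1

theorem sub_svdSum_apply_right (h : SVDSystem T σ e f) {r i : ℕ} (hi : i < r) :
    (T - svdSum σ e f r) (e i) = 0 := by
  rw [sub_apply, h.apply_right, h.svdSum_apply_right hi, sub_self]

theorem norm_sub_svdSum_le (h : SVDSystem T σ e f) (r : ℕ) :
    ‖T - svdSum σ e f r‖ ≤ σ r := by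
  refine ContinuousLinearMap.opNorm_le_bound _ (h.nonneg r) fun v => ?_
  have h1 := ((h.hasSum v).tendsto_sum_nat.sub_const (svdSum σ e f r v)).norm
  refine le_of_tendsto h1 (Filter.eventually_atTop.2 ⟨r, fun n hn => ?_⟩)
  rw [svdSum_apply, ← Finset.sum_sdiff (Finset.range_mono hn), add_sub_cancel_right]
  refine h.right.norm_sum_smul_inner_le h.left _ (h.nonneg r) (fun i hi => ?_) v
  rw [abs_of_nonneg (h.nonneg i)]
  exact h.antitone (by simpa using (Finset.mem_sdiff.1 hi).2)

theorem eq_svdSum_of_eq_zero (h : SVDSystem T σ e f) {r : ℕ} (hr : σ r = 0) :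
    T = svdSum σ e f r :=
  sub_eq_zero.1 (norm_le_zero_iff.1 ((h.norm_sub_svdSum_le r).trans hr.le))

/-- The rank counts the positive singular values: if `σ i = 0`, then `T` is its own truncation to
`i` terms; if `σ i > 0`, then `f 0, …, f i` are `i + 1` independent vectors in the range. -/
theorem svdIndex_eq (h : SVDSystem T σ e f) : svdIndex T = {i | 0 < σ i} := by
  ext i
  rw [mem_svdIndex, Set.mem_ofPred_eq]
  constructor
  · intro hi
    by_contra h0
    have h1 := h.eq_svdSum_of_eq_zero (le_antisymm (not_lt.1 h0) (h.nonneg i))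
    have h2 : T ∈ rankLE (L := F) (K := G) i := h1 ▸ svdSum_mem_rankLE i
    exact absurd hi (not_lt.2 (mem_rankLE.1 h2))
  · intro hi
    have hpos : ∀ j : Fin (i + 1), 0 < σ j := fun j =>
      hi.trans_le (h.antitone (Nat.lt_succ_iff.1 j.2))
    have hmem : ∀ j : Fin (i + 1), f j ∈ LinearMap.range (T : F →ₗ[ℝ] G) := fun j =>
      ⟨(σ j)⁻¹ • e j, by
        rw [ContinuousLinearMap.coe_coe, map_smul, h.apply_right, smul_smul,
          inv_mul_cancel₀ (hpos j).ne', one_smul]⟩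
    have hon : Orthonormal ℝ (fun j : Fin (i + 1) => f j) :=
      ⟨fun j => (h.left.norm_eq j).resolve_right (h.left_ne j (hpos j)),
        fun a b hab => h.left.inner_eq _ _ fun hh => hab (Fin.ext hh)⟩
    have hli : LinearIndependent ℝ
        (fun j : Fin (i + 1) => (⟨f j, hmem j⟩ : LinearMap.range (T : F →ₗ[ℝ] G))) := by
      refine LinearIndependent.of_comp (LinearMap.range (T : F →ₗ[ℝ] G)).subtype ?_
      exact hon.linearIndependent
    have h1 := hli.cardinal_lift_le_rank
    simp only [Cardinal.mk_fin, Cardinal.lift_natCast] at h1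
    have h2 : ((i + 1 : ℕ) : Cardinal) ≤ LinearMap.rank (T : F →ₗ[ℝ] G) := by
      simpa using h1
    exact lt_of_lt_of_le (by exact_mod_cast Nat.lt_succ_self i) h2

theorem eq_zero_of_mem_rankLE (h : SVDSystem T σ e f) {r : ℕ}
    (hr : T ∈ rankLE (L := F) (K := G) r) : σ r = 0 := by
  refine le_antisymm (not_lt.1 fun h0 => ?_) (h.nonneg r)
  have h1 : r ∈ svdIndex T := by rw [h.svdIndex_eq]; exact h0
  exact absurd (mem_svdIndex.1 h1) (not_lt.2 (mem_rankLE.1 hr))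

theorem eq_svdSum_of_mem_rankLE (h : SVDSystem T σ e f) {r : ℕ}
    (hr : T ∈ rankLE (L := F) (K := G) r) : T = svdSum σ e f r :=
  h.eq_svdSum_of_eq_zero (h.eq_zero_of_mem_rankLE hr)

theorem isSVD (h : SVDSystem T σ e f) : IsSVD T σ e f where
  nonneg i _ := h.nonneg i
  antitone := h.antitone.antitoneOn _
  orthonormal_right := h.right.orthonormal_subtype fun i hi =>
    h.right_ne i (by rw [h.svdIndex_eq] at hi; exact hi)
  orthonormal_left := h.left.orthonormal_subtype fun i hi =>
    h.left_ne i (by rw [h.svdIndex_eq] at hi; exact hi)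
  hasSum v := by
    refine (hasSum_subtype_iff_of_support_subset
      (f := fun i => (σ i * ⟪e i, v⟫_ℝ) • f i) ?_).2 (h.hasSum v)
    intro i hi
    rw [h.svdIndex_eq]
    by_contra h0
    exact hi (by simp [le_antisymm (not_lt.1 h0) (h.nonneg i)])

end SVDSystem

theorem mem_svdIndex_of_le {i j : ℕ} (hij : i ≤ j) (hj : j ∈ svdIndex T) : i ∈ svdIndex T :=
  mem_svdIndex.2 (lt_of_le_of_lt (by exact_mod_cast hij) (mem_svdIndex.1 hj))

-- Vectors are also set to zero where `σ` vanishes inside the index set, so positivity of `σ` there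
-- need not be shown first.
open scoped Classical in
theorem IsSVD.svdSystem (h : IsSVD T σ e f) :
    SVDSystem T (fun i => if i ∈ svdIndex T then σ i else 0)
      (fun i => if i ∈ svdIndex T ∧ σ i ≠ 0 then e i else 0)
      (fun i => if i ∈ svdIndex T ∧ σ i ≠ 0 then f i else 0) where
  nonneg i := by
    split_ifs with hi
    exacts [h.nonneg i hi, le_rfl]
  antitone i j hij := by
    dsimp only
    by_cases hj : j ∈ svdIndex T
    · have hi := mem_svdIndex_of_le hij hj
      rw [if_pos hi, if_pos hj]
      exact h.antitone hi hj hij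
    · rw [if_neg hj]
      split_ifs with hi
      exacts [h.nonneg i hi, le_rfl]
  right := by
    refine ⟨fun i => ?_, fun i j hij => ?_⟩
    · split_ifs with hi
      exacts [Or.inl (h.orthonormal_right.1 ⟨i, hi.1⟩), Or.inr rfl]
    · split_ifs with hi hj
      · exact h.orthonormal_right.2 (i := ⟨i, hi.1⟩) (j := ⟨j, hj.1⟩) (by simpa using hij)
      all_goals simp
  left := by
    refine ⟨fun i => ?_, fun i j hij => ?_⟩
    · split_ifs with hi
      exacts [Or.inl (h.orthonormal_left.1 ⟨i, hi.1⟩), Or.inr rfl]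
    · split_ifs with hi hj
      · exact h.orthonormal_left.2 (i := ⟨i, hi.1⟩) (j := ⟨j, hj.1⟩) (by simpa using hij)
      all_goals simp
  right_ne i hi := by
    have h1 : i ∈ svdIndex T := by
      by_contra h0
      simp [h0] at hi
    rw [if_pos h1] at hi
    rw [if_pos ⟨h1, hi.ne'⟩]
    exact h.orthonormal_right.ne_zero ⟨i, h1⟩
  left_ne i hi := by
    have h1 : i ∈ svdIndex T := by
      by_contra h0
      simp [h0] at hi
    rw [if_pos h1] at hi
    rw [if_pos ⟨h1, hi.ne'⟩]
    exact h.orthonormal_left.ne_zero ⟨i, h1⟩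
  eq_zero i hi := by
    have h1 : ¬ (i ∈ svdIndex T ∧ σ i ≠ 0) := by
      rintro ⟨h1, h2⟩
      rw [if_pos h1] at hi
      exact h2 hi
    simp only [if_neg h1, and_self]
  hasSum v := by
    refine (hasSum_subtype_iff_of_support_subset (s := svdIndex T) ?_).1 ?_
    · intro i hi
      by_contra h0
      exact hi (by simp [h0])
    · convert h.hasSum v using 2 with i
      have hi := i.2
      by_cases h0 : σ i = 0
      · simp [h0]
      · simp [hi, h0]

/-- The two normalizations differ only in terms with zero coefficient, so truncation yields the same
operators. From here on the index set can be ignored. -/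
theorem isTruncatedSVD_iff {r : ℕ} {Y : F →L[ℝ] G} :
    IsTruncatedSVD r T Y ↔ ∃ σ e f, SVDSystem T σ e f ∧ Y = svdSum σ e f r := by
  classical
  constructor
  · rintro ⟨σ, e, f, h, rfl⟩
    refine ⟨_, _, _, h.svdSystem, ?_⟩
    rw [svdSum, Finset.sum_filter]
    refine Finset.sum_congr rfl fun i _ => ?_
    by_cases hi : i ∈ svdIndex T
    · by_cases h0 : σ i = 0
      · simp [h0]
      · simp [hi, h0]
    · simp [hi]
  · rintro ⟨σ, e, f, h, rfl⟩
    refine ⟨σ, e, f, h.isSVD, ?_⟩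
    rw [svdSum, Finset.sum_filter]
    refine Finset.sum_congr rfl fun i _ => ?_
    split_ifs with hi
    · rfl
    · rw [h.svdIndex_eq] at hi
      simp [le_antisymm (not_lt.1 hi) (h.nonneg i)]

end

section

variable {F G : Type*}
  [NormedAddCommGroup F] [InnerProductSpace ℝ F] [CompleteSpace F]
  [NormedAddCommGroup G] [InnerProductSpace ℝ G] [CompleteSpace G]
  {T : F →L[ℝ] G} {σ : ℕ → ℝ} {e : ℕ → F} {f : ℕ → G}

theorem adjoint_svdSum (r : ℕ) :
    (svdSum σ e f r).adjoint = svdSum σ f e r := by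
  simp [svdSum, map_sum]

namespace SVDSystem

theorem adjoint_apply_left (h : SVDSystem T σ e f) (i : ℕ) :
    T.adjoint (f i) = σ i • e i := by
  refine ext_inner_right ℝ fun v => ?_
  rw [ContinuousLinearMap.adjoint_inner_left, real_inner_smul_left]
  refine ((h.hasSum v).mapL (innerSL ℝ (f i))).unique ?_
  convert hasSum_single i ?_ using 1
  · rcases (h.nonneg i).eq_or_lt with h0 | h0
    · simp [← h0]
    · rw [innerSL_apply_apply, inner_smul_right, real_inner_self_eq_norm_sq,
        (h.left.norm_eq i).resolve_right (h.left_ne i h0)]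
      simp
  · intro j hj
    rw [innerSL_apply_apply, inner_smul_right, h.left.inner_eq i j hj.symm, mul_zero]

theorem adjoint_sub_svdSum_apply_left (h : SVDSystem T σ e f) {r i : ℕ} (hi : i < r) :
    (T - svdSum σ e f r).adjoint (f i) = 0 := by
  rw [map_sub, adjoint_svdSum, sub_apply, h.adjoint_apply_left, h.svdSum_apply_left hi, sub_self]

end SVDSystem

end

/-! ### The Hilbert–Schmidt norm under finite-rank perturbations. -/

section

variable {ι F G : Type*}
  [NormedAddCommGroup F] [InnerProductSpace ℝ F]
  [NormedAddCommGroup G] [InnerProductSpace ℝ G]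

/-- `T` is Hilbert--Schmidt with respect to the basis `b`. -/
def IsHS (b : HilbertBasis ι ℝ F) (T : F →L[ℝ] G) : Prop := Summable fun i => ‖T (b i)‖ ^ 2

/-- The squared Hilbert--Schmidt norm of `T`, computed in the basis `b`. -/
noncomputable def hsSq (b : HilbertBasis ι ℝ F) (T : F →L[ℝ] G) : ℝ := ∑' i, ‖T (b i)‖ ^ 2

variable {b : HilbertBasis ι ℝ F} {T : F →L[ℝ] G}

theorem hsSq_nonneg : 0 ≤ hsSq b T := tsum_nonneg fun _ => sq_nonneg _

theorem hasSum_inner_sq (b : HilbertBasis ι ℝ F) (v : F) :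
    HasSum (fun i => ⟪v, b i⟫_ℝ ^ 2) (‖v‖ ^ 2) := by
  have := b.hasSum_inner_mul_inner v v
  rw [real_inner_self_eq_norm_sq] at this
  have h1 : (fun i => ⟪v, b i⟫_ℝ ^ 2) = fun i => ⟪v, b i⟫_ℝ * ⟪b i, v⟫_ℝ :=
    funext fun i => by rw [real_inner_comm v (b i), sq]
  rw [h1]
  exact this

theorem IsHS.hasSum (hT : IsHS b T) : HasSum (fun i => ‖T (b i)‖ ^ 2) (hsSq b T) :=
  Summable.hasSum hT

end

section

variable {ι F G : Type*}
  [NormedAddCommGroup F] [InnerProductSpace ℝ F] [CompleteSpace F]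
  [NormedAddCommGroup G] [InnerProductSpace ℝ G] [CompleteSpace G]
  {b : HilbertBasis ι ℝ F} {T : F →L[ℝ] G}

/-- Expand the square and apply Parseval to each term. All perturbation arguments below proceed by
rank-one updates, so this formula replaces a Hilbert–Schmidt inner product. -/
theorem hasSum_norm_sq_add_rankOne (hT : IsHS b T) (u : G) (v : F) :
    HasSum (fun i => ‖(T + rankOne ℝ u v) (b i)‖ ^ 2)
      (hsSq b T + 2 * ⟪u, T v⟫_ℝ + ‖u‖ ^ 2 * ‖v‖ ^ 2) := by
  have h1 := b.hasSum_inner_mul_inner v (T.adjoint u)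
  have h2 := b.hasSum_inner_mul_inner v v
  rw [ContinuousLinearMap.adjoint_inner_right, real_inner_comm] at h1
  rw [real_inner_self_eq_norm_sq] at h2
  convert (hT.hasSum.add (h1.mul_left 2)).add (h2.mul_left (‖u‖ ^ 2)) using 2 with i
  rw [ContinuousLinearMap.adjoint_inner_right, add_apply, rankOne_apply, norm_add_sq_real,
    inner_smul_right, norm_smul, mul_pow, Real.norm_eq_abs, sq_abs, real_inner_comm v (b i)]
  ring

theorem IsHS.add_rankOne (hT : IsHS b T) (u : G) (v : F) : IsHS b (T + rankOne ℝ u v) :=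
  (hasSum_norm_sq_add_rankOne hT u v).summable

theorem hsSq_add_rankOne (hT : IsHS b T) (u : G) (v : F) :
    hsSq b (T + rankOne ℝ u v) = hsSq b T + 2 * ⟪u, T v⟫_ℝ + ‖u‖ ^ 2 * ‖v‖ ^ 2 :=
  (hasSum_norm_sq_add_rankOne hT u v).tsum_eq

theorem IsHS.sub_rankOne (hT : IsHS b T) (u : G) (v : F) : IsHS b (T - rankOne ℝ u v) := by
  simpa [sub_eq_add_neg] using hT.add_rankOne (-u) v

theorem hsSq_sub_rankOne (hT : IsHS b T) (u : G) (v : F) :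
    hsSq b (T - rankOne ℝ u v) = hsSq b T - 2 * ⟪u, T v⟫_ℝ + ‖u‖ ^ 2 * ‖v‖ ^ 2 := by
  have := hsSq_add_rankOne hT (-u) v
  simp only [map_neg, neg_apply, inner_neg_left, norm_neg] at this
  rw [sub_eq_add_neg, this]
  ring

theorem IsHS.sub_sum_rankOne (hT : IsHS b T) {κ : Type*} (s : Finset κ) (u : κ → G) (v : κ → F) :
    IsHS b (T - ∑ i ∈ s, rankOne ℝ (u i) (v i)) := by
  classical
  induction s using Finset.induction_on with
  | empty => simpa using hT
  | insert a s ha ih =>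
    rw [Finset.sum_insert ha, add_comm, ← sub_sub]
    exact ih.sub_rankOne _ _

/-- Summability has to be known before errors are compared, because `hsSq` takes the value 0 on a
divergent series. -/
theorem IsHS.sub_of_mem_rankLE (hT : IsHS b T) {r : ℕ} {B : F →L[ℝ] G}
    (hB : B ∈ rankLE (L := F) (K := G) r) : IsHS b (T - B) := by
  obtain ⟨σ, e, f, h, -⟩ := exists_svdSystem (isCompactOperator_of_mem_rankLE hB)
  have := hT.sub_sum_rankOne (Finset.range r) (fun i => σ i • f i) e
  rw [h.eq_svdSum_of_mem_rankLE hB]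
  simpa [svdSum] using this

theorem continuous_hsSq_sub_sum_rankOne (hT : IsHS b T) {κ : Type*} (s : Finset κ) (v : κ → F) :
    Continuous fun u : κ → G => hsSq b (T - ∑ i ∈ s, rankOne ℝ (u i) (v i)) := by
  classical
  induction s using Finset.induction_on with
  | empty => simpa using continuous_const
  | insert a s ha ih =>
    have h1 : (fun u : κ → G => hsSq b (T - ∑ i ∈ insert a s, rankOne ℝ (u i) (v i))) = fun u =>
        hsSq b (T - ∑ i ∈ s, rankOne ℝ (u i) (v i)) -
          2 * ⟪u a, T (v a) - ∑ i ∈ s, ⟪v i, v a⟫_ℝ • u i⟫_ℝ + ‖u a‖ ^ 2 * ‖v a‖ ^ 2 := by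
      funext u
      rw [Finset.sum_insert ha, add_comm, ← sub_sub,
        hsSq_sub_rankOne (hT.sub_sum_rankOne s u v)]
      simp
    rw [h1]
    fun_prop

/-- For a unit vector `v`, subtracting `T v ⊗ v` leaves a squared norm of `hsSq b T - ‖T v‖²`, which
is nonnegative. -/
theorem norm_sq_le_hsSq (hT : IsHS b T) : ‖T‖ ^ 2 ≤ hsSq b T := by
  have h1 : ∀ v : F, ‖v‖ = 1 → ‖T v‖ ^ 2 ≤ hsSq b T := fun v hv => by
    have h2 := hsSq_sub_rankOne hT (T v) v
    have h3 : 0 ≤ hsSq b (T - rankOne ℝ (T v) v) := hsSq_nonneg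
    rw [h2, hv, real_inner_self_eq_norm_sq] at h3
    linarith
  have h4 : ‖T‖ ≤ Real.sqrt (hsSq b T) := by
    refine ContinuousLinearMap.opNorm_le_of_unit_norm (Real.sqrt_nonneg _) fun v hv => ?_
    exact Real.le_sqrt_of_sq_le (h1 v hv)
  calc ‖T‖ ^ 2 ≤ Real.sqrt (hsSq b T) ^ 2 := pow_le_pow_left₀ (norm_nonneg _) h4 2
    _ = _ := Real.sq_sqrt hsSq_nonneg

theorem IsHS.isCompactOperator (hT : IsHS b T) : IsCompactOperator T := by
  classical
  let S : Finset ι → F →L[ℝ] G := fun s => ∑ i ∈ s, rankOne ℝ (T (b i)) (b i)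
  have hS : ∀ s, IsHS b (T - S s) := fun s => hT.sub_sum_rankOne s _ _
  have hSb : ∀ s i, (T - S s) (b i) = if i ∈ s then 0 else T (b i) := fun s i => by
    simp only [S, sub_apply, sum_apply, rankOne_apply, orthonormal_iff_ite.1 b.orthonormal]
    split_ifs with hi <;> simp [hi]
  have hval : ∀ s, hsSq b (T - S s) = ∑' i : {i // i ∉ s}, ‖T (b i)‖ ^ 2 := fun s => by
    rw [hsSq]
    refine (tsum_subtype_eq_of_support_subset (s := {i | i ∉ s}) ?_).symm.trans ?_
    · intro i hi
      by_contra h0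
      have h1 : i ∈ s := by simpa using h0
      exact hi (by simp [hSb, h1])
    · refine tsum_congr fun i => ?_
      rw [hSb, if_neg i.2]
  have hlim : Filter.Tendsto S Filter.atTop (nhds T) := by
    rw [tendsto_iff_norm_sub_tendsto_zero]
    have h1 : Filter.Tendsto (fun s => Real.sqrt (hsSq b (T - S s))) Filter.atTop (nhds 0) := by
      simp only [hval]
      simpa using (tendsto_tsum_compl_atTop_zero fun i => ‖T (b i)‖ ^ 2).sqrt
    refine squeeze_zero (fun _ => norm_nonneg _) (fun s => ?_) h1
    rw [norm_sub_rev]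
    exact Real.le_sqrt_of_sq_le (norm_sq_le_hsSq (hS s))
  refine isCompactOperator_of_tendsto hlim (Filter.Eventually.of_forall fun s => ?_)
  refine Submodule.sum_mem (compactOperator (RingHom.id ℝ) F G) (t := s)
    (f := fun i => rankOne ℝ (T (b i)) (b i)) fun i _ => ?_
  have := sum_rankOne_mem_rankLE 1 (fun _ => T (b i)) (fun _ => b i)
  rw [Finset.sum_range_one] at this
  exact isCompactOperator_of_mem_rankLE this

/-! ### The Eckart–Young theorem. -/

/-- The first `r` terms of a singular value decomposition of `T` form a best approximation of
`T` in the Hilbert--Schmidt norm among operators of rank at most `r`. -/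
theorem SVDSystem.hsSq_sub_svdSum_le {σ : ℕ → ℝ} {e : ℕ → F} {f : ℕ → G} (h : SVDSystem T σ e f)
    (hT : IsHS b T) {r : ℕ} {B : F →L[ℝ] G} (hB : B ∈ rankLE (L := F) (K := G) r) :
    hsSq b (T - svdSum σ e f r) ≤ hsSq b (T - B) := by
  have := finiteDimensional_range_of_mem_rankLE hB
  have hk : Module.finrank ℝ B.range ≤ r := Module.finrank_le_of_rank_le hB
  set k := Module.finrank ℝ B.range with hkdef
  let q' := stdOrthonormalBasis ℝ B.range
  let q : Fin k → G := fun j => q' j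
  have hq : Orthonormal ℝ q := q'.orthonormal.comp_linearIsometry B.range.subtypeₗᵢ
  have hqp : PartialOrthonormal q := ⟨fun j => Or.inl (hq.1 j), fun _ _ hij => hq.2 hij⟩
  set N := T - svdSum σ e f r with hN
  have hTN : T = svdSum σ e f r + N := by rw [hN]; abel
  -- the value at the truncation
  have hval : hsSq b N = hsSq b T - ∑ i ∈ Finset.range r, σ i ^ 2 := by
    have h1 : ∀ v, ‖N v‖ ^ 2 = ‖T v‖ ^ 2 - ∑ i ∈ Finset.range r, σ i ^ 2 * ⟪e i, v⟫_ℝ ^ 2 := by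
      intro v
      have h2 : ⟪svdSum σ e f r v, N v⟫_ℝ = 0 := by
        rw [svdSum_apply, sum_inner]
        refine Finset.sum_eq_zero fun i hi => ?_
        rw [real_inner_smul_left, ← ContinuousLinearMap.adjoint_inner_left,
          h.adjoint_sub_svdSum_apply_left (Finset.mem_range.1 hi), inner_zero_left, mul_zero]
      have h3 : ‖T v‖ ^ 2 = ‖svdSum σ e f r v‖ ^ 2 + ‖N v‖ ^ 2 := by
        have h3' : T v = svdSum σ e f r v + N v := by rw [hN, sub_apply]; abel
        rw [h3', norm_add_sq_real, h2]
        ring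
      rw [h3, svdSum_apply, h.left.norm_sq_sum, add_comm, add_sub_assoc, left_eq_add,
        sub_eq_zero]
      refine Finset.sum_congr rfl fun i _ => ?_
      rcases h.left.norm_eq i with h0 | h0
      · rw [h0]; ring
      · rcases (h.nonneg i).eq_or_lt with h1 | h1
        · simp [← h1]
        · exact absurd h0 (h.left_ne i h1)
    have h4 : HasSum (fun i => ‖N (b i)‖ ^ 2)
        (hsSq b T - ∑ i ∈ Finset.range r, σ i ^ 2 * ‖e i‖ ^ 2) := by
      simp only [h1]
      refine hT.hasSum.sub (hasSum_sum fun i _ => ?_)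
      exact (hasSum_inner_sq b (e i)).mul_left _
    rw [hsSq, h4.tsum_eq]
    congr 1
    refine Finset.sum_congr rfl fun i _ => ?_
    rcases h.right.norm_eq i with h0 | h0
    · rw [h0]; ring
    · rcases (h.nonneg i).eq_or_lt with h1 | h1
      · simp [← h1]
      · exact absurd h0 (h.right_ne i h1)
  -- the lower bound by projecting onto the range of `B`
  have hlow : hsSq b T - ∑ j, ‖T.adjoint (q j)‖ ^ 2 ≤ hsSq b (T - B) := by
    have h1 : HasSum (fun i => ‖T (b i)‖ ^ 2 - ∑ j, ⟪q j, T (b i)⟫_ℝ ^ 2)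
        (hsSq b T - ∑ j, ‖T.adjoint (q j)‖ ^ 2) := by
      refine hT.hasSum.sub (hasSum_sum fun j _ => ?_)
      simpa only [ContinuousLinearMap.adjoint_inner_left] using
        hasSum_inner_sq b (T.adjoint (q j))
    refine hasSum_le (fun i => ?_) h1 (hT.sub_of_mem_rankLE hB).hasSum
    rw [← hqp.norm_sq_sub_sum]
    set w := (T - B) (b i) with hw
    have hTw : T (b i) = w + B (b i) := by rw [hw, sub_apply]; abel
    have hBq : B (b i) = ∑ j, ⟪q j, B (b i)⟫_ℝ • q j := by
      have := congrArg (Subtype.val) (q'.sum_repr' ⟨B (b i), ⟨b i, rfl⟩⟩)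
      simpa [q] using this.symm
    -- Subtracting `B` does not affect the component orthogonal to the range of `B`.
    have h2 : T (b i) - ∑ j, ⟪q j, T (b i)⟫_ℝ • q j = w - ∑ j, ⟪q j, w⟫_ℝ • q j := by
      simp only [hTw, inner_add_right, add_smul, Finset.sum_add_distrib]
      rw [← hBq]
      abel
    rw [h2, hqp.norm_sq_sub_sum]
    exact sub_le_self _ (Finset.sum_nonneg fun _ _ => sq_nonneg _)
  -- the estimate for the adjoint
  have hadj : ∀ g : G, ‖T.adjoint g‖ ^ 2 ≤ ∑ i ∈ Finset.range r, (σ i ^ 2 - σ r ^ 2) *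
      ⟪f i, g⟫_ℝ ^ 2 + σ r ^ 2 * ‖g‖ ^ 2 := by
    intro g
    have h1 : T.adjoint g = svdSum σ f e r g + N.adjoint g := by
      rw [← adjoint_svdSum, ← add_apply, ← map_add, ← hTN]
    have h2 : ⟪svdSum σ f e r g, N.adjoint g⟫_ℝ = 0 := by
      rw [ContinuousLinearMap.adjoint_inner_right, svdSum_apply, map_sum, sum_inner]
      refine Finset.sum_eq_zero fun i hi => ?_
      rw [map_smul, h.sub_svdSum_apply_right (Finset.mem_range.1 hi), smul_zero, inner_zero_left]
    have h3 : N.adjoint g = N.adjoint (g - ∑ i ∈ Finset.range r, ⟪f i, g⟫_ℝ • f i) := by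
      rw [map_sub N.adjoint, map_sum N.adjoint, Finset.sum_eq_zero, sub_zero]
      intro i hi
      rw [map_smul N.adjoint, h.adjoint_sub_svdSum_apply_left (Finset.mem_range.1 hi), smul_zero]
    have h4 : ‖N.adjoint g‖ ^ 2 ≤ σ r ^ 2 * (‖g‖ ^ 2 - ∑ i ∈ Finset.range r, ⟪f i, g⟫_ℝ ^ 2) := by
      rw [← h.left.norm_sq_sub_sum, ← mul_pow, h3]
      refine pow_le_pow_left₀ (norm_nonneg _) ((N.adjoint.le_opNorm _).trans ?_) 2
      rw [LinearIsometryEquiv.norm_map]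
      exact mul_le_mul_of_nonneg_right (h.norm_sub_svdSum_le r) (norm_nonneg _)
    have h5 : ‖svdSum σ f e r g‖ ^ 2 ≤ ∑ i ∈ Finset.range r, σ i ^ 2 * ⟪f i, g⟫_ℝ ^ 2 := by
      rw [svdSum_apply, h.right.norm_sq_sum]
      refine Finset.sum_le_sum fun i _ => ?_
      rw [← mul_pow (σ i)]
      exact mul_le_of_le_one_right (sq_nonneg _)
        (pow_le_one₀ (norm_nonneg _) (h.right.norm_le_one i))
    rw [h1, norm_add_sq_real, h2]
    simp only [sub_mul, Finset.sum_sub_distrib, ← Finset.mul_sum]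
    linarith
  -- Sum the estimate over the orthonormal `q j`: the weights `σ i ^ 2 - σ r ^ 2` are nonnegative
  -- for `i < r`, Bessel bounds each inner sum by 1, and `k ≤ r` handles the constant term.
  have hsum : ∑ j, ‖T.adjoint (q j)‖ ^ 2 ≤ ∑ i ∈ Finset.range r, σ i ^ 2 := by
    calc ∑ j, ‖T.adjoint (q j)‖ ^ 2
        ≤ ∑ j, (∑ i ∈ Finset.range r, (σ i ^ 2 - σ r ^ 2) * ⟪f i, q j⟫_ℝ ^ 2 + σ r ^ 2) :=
          Finset.sum_le_sum fun j _ => by simpa [hq.1 j] using hadj (q j)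
      _ = ∑ i ∈ Finset.range r, (σ i ^ 2 - σ r ^ 2) * ∑ j, ⟪q j, f i⟫_ℝ ^ 2 + k * σ r ^ 2 := by
          rw [Finset.sum_add_distrib, Finset.sum_comm]
          simp [Finset.mul_sum, real_inner_comm]
      _ ≤ ∑ i ∈ Finset.range r, (σ i ^ 2 - σ r ^ 2) + r * σ r ^ 2 := by
          gcongr with i hi
          refine mul_le_of_le_one_right ?_ ?_
          · exact sub_nonneg.2 (pow_le_pow_left₀ (h.nonneg r)
              (h.antitone (Finset.mem_range.1 hi).le) 2)
          · exact (hqp.sum_inner_sq_le _ _).trans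
              (pow_le_one₀ (norm_nonneg _) (h.left.norm_le_one i))
      _ = _ := by simp
  linarith

end

/-! ### Best approximations are truncated SVDs. -/

section

variable {F G : Type*} [NormedAddCommGroup F] [InnerProductSpace ℝ F]
  [NormedAddCommGroup G] [InnerProductSpace ℝ G]

theorem PartialOrthonormal.append {e e' : ℕ → F} (he : PartialOrthonormal e)
    (he' : PartialOrthonormal e') (h : ∀ i j, ⟪e i, e' j⟫_ℝ = 0) (r : ℕ) :
    PartialOrthonormal (fun i => if i < r then e i else e' (i - r)) where
  norm_eq i := by
    split_ifs
    exacts [he.norm_eq i, he'.norm_eq _]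
  inner_eq i j hij := by
    split_ifs
    · exact he.inner_eq i j hij
    · exact h i _
    · rw [real_inner_comm]; exact h j _
    · exact he'.inner_eq _ _ (by omega)

theorem svdSum_append {σ σ' : ℕ → ℝ} {e e' : ℕ → F} {f f' : ℕ → G} (r : ℕ) :
    svdSum (fun i => if i < r then σ i else σ' (i - r))
      (fun i => if i < r then e i else e' (i - r))
      (fun i => if i < r then f i else f' (i - r)) r = svdSum σ e f r := by
  refine Finset.sum_congr rfl fun i hi => ?_
  simp [Finset.mem_range.1 hi]

end

section

variable {ι F G : Type*}
  [NormedAddCommGroup F] [InnerProductSpace ℝ F] [CompleteSpace F]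
  [NormedAddCommGroup G] [InnerProductSpace ℝ G] [CompleteSpace G]
  {b : HilbertBasis ι ℝ F} {T B : F →L[ℝ] G}

/-- The vanishing conditions make the singular vectors of `N` orthogonal to those of `Y`, and `hσ`
keeps the concatenated singular values nonincreasing. -/
theorem SVDSystem.append {σ σ' : ℕ → ℝ} {e e' : ℕ → F} {f f' : ℕ → G} {r : ℕ} {Y N : F →L[ℝ] G}
    (h : SVDSystem Y σ e f) (h' : SVDSystem N σ' e' f') (hY : Y = svdSum σ e f r)
    (hσ : ∀ i < r, σ' 0 ≤ σ i) (hNe : ∀ i, N (e i) = 0) (hNf : ∀ i, N.adjoint (f i) = 0) :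
    SVDSystem (Y + N) (fun i => if i < r then σ i else σ' (i - r))
      (fun i => if i < r then e i else e' (i - r))
      (fun i => if i < r then f i else f' (i - r)) where
  nonneg i := by
    split_ifs
    exacts [h.nonneg i, h'.nonneg _]
  antitone i j hij := by
    dsimp only
    split_ifs with h1 h2 h2
    · exact h.antitone hij
    · omega
    · exact (h'.antitone (Nat.zero_le _)).trans (hσ i h2)
    · exact h'.antitone (by omega)
  right := by
    refine h.right.append h'.right (fun i j => ?_) r
    rcases (h'.nonneg j).eq_or_lt with h0 | h0
    · rw [(h'.eq_zero j h0.symm).1, inner_zero_right]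
    · have h1 : ⟪N.adjoint (f' j), e i⟫_ℝ = 0 := by
        rw [ContinuousLinearMap.adjoint_inner_left, hNe, inner_zero_right]
      rw [h'.adjoint_apply_left, real_inner_smul_left] at h1
      rw [real_inner_comm]
      exact (mul_eq_zero.1 h1).resolve_left h0.ne'
  left := by
    refine h.left.append h'.left (fun i j => ?_) r
    rcases (h'.nonneg j).eq_or_lt with h0 | h0
    · rw [(h'.eq_zero j h0.symm).2, inner_zero_right]
    · have h1 : ⟪N (e' j), f i⟫_ℝ = 0 := by
        rw [← ContinuousLinearMap.adjoint_inner_right, hNf, inner_zero_right]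
      rw [h'.apply_right, real_inner_smul_left] at h1
      rw [real_inner_comm]
      exact (mul_eq_zero.1 h1).resolve_left h0.ne'
  right_ne i hi := by
    split_ifs at hi ⊢ with h1
    exacts [h.right_ne i hi, h'.right_ne _ hi]
  left_ne i hi := by
    split_ifs at hi ⊢ with h1
    exacts [h.left_ne i hi, h'.left_ne _ hi]
  eq_zero i hi := by
    split_ifs at hi ⊢ with h1
    exacts [h.eq_zero i hi, h'.eq_zero _ hi]
  hasSum v := by
    rw [add_apply, add_comm, hY, svdSum_apply]
    have h1 := (hasSum_nat_add_iff (G := G) (g := N v)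
      (f := fun i => ((if i < r then σ i else σ' (i - r)) *
        ⟪if i < r then e i else e' (i - r), v⟫_ℝ) • (if i < r then f i else f' (i - r))) r).1
      (by simpa using h'.hasSum v)
    convert h1 using 2
    refine Finset.sum_congr rfl fun i hi => ?_
    simp [Finset.mem_range.1 hi]

/-- Best approximations of `T` of rank at most `r` in the Hilbert--Schmidt norm are truncations of
singular value decompositions of `T`. -/
theorem isTruncatedSVD_of_forall_hsSq_le (hT : IsHS b T) {r : ℕ}
    (hB : B ∈ rankLE (L := F) (K := G) r)
    (hmin : ∀ B' ∈ rankLE (L := F) (K := G) r, hsSq b (T - B) ≤ hsSq b (T - B')) :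
    IsTruncatedSVD r T B := by
  obtain ⟨σ, e, f, h, -⟩ := exists_svdSystem (isCompactOperator_of_mem_rankLE hB)
  have hHS := hT.sub_of_mem_rankLE hB
  set N := T - B with hN
  have hBeq := h.eq_svdSum_of_mem_rankLE hB
  obtain ⟨σ', e', f', h', -⟩ := exists_svdSystem hHS.isCompactOperator
  -- The perturbation `f i ⊗ N* (f i)` keeps the range inside that of `B`, hence the rank, and
  -- lowers the error by `‖N* (f i)‖²`. The argument for `hNe` is the mirror image, composing on the
  -- other side.
  have hNf : ∀ i, N.adjoint (f i) = 0 := by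
    intro i
    rcases (h.nonneg i).eq_or_lt with h0 | h0
    · rw [(h.eq_zero i h0.symm).2, map_zero]
    have h1 := hmin (B + rankOne ℝ (f i) (N.adjoint (f i))) (by
      have h2 : B + rankOne ℝ (f i) (N.adjoint (f i)) = B ∘L (ContinuousLinearMap.id ℝ F +
          rankOne ℝ ((σ i)⁻¹ • e i) (N.adjoint (f i))) := by
        rw [ContinuousLinearMap.comp_add, comp_rankOne, map_smul, h.apply_right, smul_smul,
          inv_mul_cancel₀ h0.ne', one_smul, ContinuousLinearMap.comp_id]
      rw [h2]
      exact (LinearMap.rank_comp_le_left _ _).trans hB)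
    rw [← sub_sub, ← hN, hsSq_sub_rankOne hHS, ← ContinuousLinearMap.adjoint_inner_left,
      real_inner_self_eq_norm_sq, (h.left.norm_eq i).resolve_right (h.left_ne i h0)] at h1
    exact norm_eq_zero.1 (pow_eq_zero_iff two_ne_zero |>.1
      (le_antisymm (by linarith) (sq_nonneg ‖N.adjoint (f i)‖)))
  have hNe : ∀ i, N (e i) = 0 := by
    intro i
    rcases (h.nonneg i).eq_or_lt with h0 | h0
    · rw [(h.eq_zero i h0.symm).1, map_zero]
    have h1 := hmin (B + rankOne ℝ (N (e i)) (e i)) (by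
      have h2 : B + rankOne ℝ (N (e i)) (e i) = (ContinuousLinearMap.id ℝ G +
          rankOne ℝ (N (e i)) ((σ i)⁻¹ • f i)) ∘L B := by
        rw [ContinuousLinearMap.add_comp, rankOne_comp, map_smul, h.adjoint_apply_left, smul_smul,
          inv_mul_cancel₀ h0.ne', one_smul, ContinuousLinearMap.id_comp]
      rw [h2]
      exact (LinearMap.rank_comp_le_right _ _).trans hB)
    rw [← sub_sub, ← hN, hsSq_sub_rankOne hHS,
      real_inner_self_eq_norm_sq, (h.right.norm_eq i).resolve_right (h.right_ne i h0)] at h1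
    exact norm_eq_zero.1 (pow_eq_zero_iff two_ne_zero |>.1
      (le_antisymm (by linarith) (sq_nonneg ‖N (e i)‖)))
  -- Otherwise replace the last pair of `B`, of index `k = r - 1`, by the top pair of the residual:
  -- the error drops by `σ' 0 ^ 2` and grows by at most `σ k ^ 2`.
  have hσ : ∀ i < r, σ' 0 ≤ σ i := by
    intro i hi
    obtain ⟨k, rfl⟩ : ∃ k, r = k + 1 := ⟨r - 1, by omega⟩
    refine le_trans ?_ (h.antitone (Nat.lt_succ_iff.1 hi))
    by_contra! hlt
    have h0 : 0 < σ' 0 := (h.nonneg k).trans_lt hlt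
    have h1 := hmin (B + rankOne ℝ (σ' 0 • f' 0) (e' 0) - rankOne ℝ (σ k • f k) (e k)) (by
      have h2 := sum_rankOne_mem_rankLE (k + 1)
        (fun i => if i < k then σ i • f i else σ' 0 • f' 0) (fun i => if i < k then e i else e' 0)
      convert h2 using 1
      rw [hBeq, svdSum, Finset.sum_range_succ, Finset.sum_range_succ]
      simp only [lt_irrefl, if_false, map_smul, smul_apply]
      have h3 : ∑ i ∈ Finset.range k, rankOne ℝ (if i < k then σ i • f i else σ' 0 • f' 0)
          (if i < k then e i else e' 0) = ∑ i ∈ Finset.range k, σ i • rankOne ℝ (f i) (e i) :=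
        Finset.sum_congr rfl fun i hi => by simp [Finset.mem_range.1 hi]
      rw [h3]
      abel)
    have h2 : T - (B + rankOne ℝ (σ' 0 • f' 0) (e' 0) - rankOne ℝ (σ k • f k) (e k)) =
        N - rankOne ℝ (σ' 0 • f' 0) (e' 0) + rankOne ℝ (σ k • f k) (e k) := by
      rw [hN]; abel
    have h3 : ⟪e' 0, e k⟫_ℝ = 0 := by
      have h4 : ⟪N.adjoint (f' 0), e k⟫_ℝ = 0 := by
        rw [ContinuousLinearMap.adjoint_inner_left, hNe, inner_zero_right]
      rw [h'.adjoint_apply_left, real_inner_smul_left] at h4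
      exact (mul_eq_zero.1 h4).resolve_left h0.ne'
    have h7 : (N - rankOne ℝ (σ' 0 • f' 0) (e' 0)) (e k) = 0 := by
      rw [sub_apply, hNe, rankOne_apply, h3, zero_smul, sub_zero]
    rw [h2, hsSq_add_rankOne (hHS.sub_rankOne _ _), hsSq_sub_rankOne hHS, h7, h'.apply_right, real_inner_self_eq_norm_sq, norm_smul, norm_smul,
      (h'.left.norm_eq 0).resolve_right (h'.left_ne 0 h0),
      (h'.right.norm_eq 0).resolve_right (h'.right_ne 0 h0), Real.norm_of_nonneg h0.le,
      Real.norm_of_nonneg (h.nonneg k)] at h1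
    simp only [inner_zero_right, mul_zero, add_zero, mul_one, one_pow] at h1
    have h5 : (σ k * ‖f k‖) ^ 2 * ‖e k‖ ^ 2 ≤ σ k ^ 2 := by
      rw [← mul_pow, mul_assoc]
      refine pow_le_pow_left₀ (by have := h.nonneg k; positivity) ?_ 2
      exact mul_le_of_le_one_right (h.nonneg k)
        (mul_le_one₀ (h.left.norm_le_one k) (norm_nonneg _) (h.right.norm_le_one k))
    have h6 : σ k ^ 2 < σ' 0 ^ 2 := pow_lt_pow_left₀ hlt (h.nonneg k) two_ne_zero
    linarith
  have hTN : T = B + N := by rw [hN]; abel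
  rw [isTruncatedSVD_iff, hTN]
  refine ⟨_, _, _, h.append h' hBeq hσ hNe hNf, ?_⟩
  rw [svdSum_append, ← hBeq]

end

/-! ### Kernels and square roots of positive operators. -/

section

variable {H K : Type*} [NormedAddCommGroup H] [InnerProductSpace ℝ H]
  [NormedAddCommGroup K] [InnerProductSpace ℝ K]

theorem eq_of_mem_ker_orthogonal {S : H →L[ℝ] K} {u v : H} (hu : u ∈ S.kerᗮ) (hv : v ∈ S.kerᗮ)
    (h : S u = S v) : u = v := by
  have h1 : u - v ∈ S.ker := by
    show S (u - v) = 0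
    rw [map_sub, h, sub_self]
  have h2 := Submodule.inner_right_of_mem_orthogonal h1 (Submodule.sub_mem _ hu hv)
  exact sub_eq_zero.1 (inner_self_eq_zero.1 h2)

theorem inner_apply_self_of_comp_self_eq {C S : H →L[ℝ] H} (hS : S.IsPositive)
    (hSC : S ∘L S = C) (a : H) : ⟪C a, a⟫_ℝ = ‖S a‖ ^ 2 := by
  rw [← hSC, ContinuousLinearMap.comp_apply, hS.inner_left_eq_inner_right,
    real_inner_self_eq_norm_sq]

theorem ker_eq_of_comp_self_eq {C S : H →L[ℝ] H} (hS : S.IsPositive) (hSC : S ∘L S = C) :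
    C.ker = S.ker := by
  ext a
  constructor
  · intro h
    have h1 : C a = 0 := h
    have h2 := inner_apply_self_of_comp_self_eq hS hSC a
    rw [h1, inner_zero_left] at h2
    exact norm_eq_zero.1 (pow_eq_zero_iff two_ne_zero |>.1 h2.symm)
  · intro h
    have h1 : S a = 0 := h
    show C a = 0
    rw [← hSC, ContinuousLinearMap.comp_apply, h1, map_zero]

end

section Sqrt

variable {G : Type*} [NormedAddCommGroup G] [InnerProductSpace ℝ G] [CompleteSpace G]

/-- The singular value decomposition of a positive operator is a spectral decomposition. -/
theorem SVDSystem.left_eq_right_of_isPositive {C : G →L[ℝ] G} (hC : C.IsPositive) {σ : ℕ → ℝ}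
    {e f : ℕ → G} (h : SVDSystem C σ e f) : f = e := by
  funext i
  rcases (h.nonneg i).eq_or_lt with h0 | h0
  · rw [(h.eq_zero i h0.symm).1, (h.eq_zero i h0.symm).2]
  have h1 : C (f i) = σ i • e i := by
    have := h.adjoint_apply_left i
    rwa [hC.isSelfAdjoint.adjoint_eq] at this
  -- `f i - e i` satisfies the eigenvector equation with eigenvalue `-σ i < 0`, so positivity forces
  -- it to vanish.
  have h2 : C (f i - e i) = -(σ i • (f i - e i)) := by
    rw [map_sub, h1, h.apply_right, smul_sub, neg_sub]
  have h3 := hC.inner_nonneg_left (f i - e i)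
  rw [h2, inner_neg_left, real_inner_smul_left, real_inner_self_eq_norm_sq] at h3
  have h4 : ‖f i - e i‖ ^ 2 ≤ 0 := by
    by_contra! h5
    have := mul_pos h0 h5
    linarith
  exact sub_eq_zero.1 (norm_eq_zero.1 (pow_eq_zero_iff two_ne_zero |>.1
    (le_antisymm h4 (sq_nonneg _))))

/-- The root is the operator-norm limit of the spectral sums with coefficients `√(σ i)`; their tails
are bounded by `√(σ n)`, which tends to zero. -/
theorem exists_isPositive_comp_self_eq {C : G →L[ℝ] G} (hC : C.IsPositive)
    (hc : IsCompactOperator C) : ∃ S : G →L[ℝ] G, S.IsPositive ∧ S ∘L S = C := by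
  obtain ⟨σ, e, f, h, hσ⟩ := exists_svdSystem hc
  obtain rfl := h.left_eq_right_of_isPositive hC
  set S : ℕ → G →L[ℝ] G := svdSum (fun i => Real.sqrt (σ i)) f f with hSdef
  have hcauchy : CauchySeq S := by
    refine cauchySeq_of_le_tendsto_0' (fun n => Real.sqrt (σ n)) (fun n m hnm => ?_)
      (by simpa using hσ.sqrt)
    rw [dist_comm, dist_eq_norm]
    refine ContinuousLinearMap.opNorm_le_bound _ (Real.sqrt_nonneg _) fun v => ?_
    rw [sub_apply, hSdef, svdSum_apply, svdSum_apply,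
      ← Finset.sum_sdiff (Finset.range_mono hnm), add_sub_cancel_right]
    refine h.right.norm_sum_smul_inner_le h.left _ (Real.sqrt_nonneg _) (fun i hi => ?_) v
    rw [abs_of_nonneg (Real.sqrt_nonneg _)]
    exact Real.sqrt_le_sqrt (h.antitone (by simpa using (Finset.mem_sdiff.1 hi).2))
  obtain ⟨R, hR⟩ := cauchySeq_tendsto_of_complete hcauchy
  have hpos : ∀ n, (S n).IsPositive := fun n =>
    ContinuousLinearMap.isPositive_sum _ fun i _ =>
      (isPositive_rankOne_self (f i)).smul_of_nonneg (Real.sqrt_nonneg _)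
  have happ : ∀ v, Filter.Tendsto (fun n => S n v) Filter.atTop (nhds (R v)) := fun v =>
    ((ContinuousLinearMap.apply ℝ G v).continuous.tendsto R).comp hR
  refine ⟨R, (ContinuousLinearMap.isPositive_iff R).2 ⟨fun v w => ?_, fun v => ?_⟩, ?_⟩
  · refine tendsto_nhds_unique ((happ v).inner tendsto_const_nhds)
      (Filter.Tendsto.congr (fun n => ?_) (Filter.Tendsto.inner tendsto_const_nhds (happ w)))
    exact ((hpos n).inner_left_eq_inner_right v w).symm
  · exact ge_of_tendsto' ((happ v).inner tendsto_const_nhds) fun n => (hpos n).inner_nonneg_left v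
  · ext v
    have h1 : Filter.Tendsto (fun n => S n (S n v)) Filter.atTop (nhds (R (R v))) :=
      (isBoundedBilinearMap_apply.continuous.tendsto (R, R v)).comp (hR.prodMk_nhds (happ v))
    refine tendsto_nhds_unique h1 ((h.hasSum v).tendsto_sum_nat.congr fun n => ?_)
    rw [hSdef, svdSum_apply n v, svdSum_apply]
    refine Finset.sum_congr rfl fun i hi => ?_
    rw [h.left.inner_sum_smul _ _ hi]
    rcases (h.nonneg i).eq_or_lt with h0 | h0
    · simp [← h0]
    · rw [(h.left.norm_eq i).resolve_right (h.left_ne i h0), one_pow, mul_one, ← mul_assoc,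
        Real.mul_self_sqrt h0.le]

/-- Only these two properties of the chosen root are used later; its uniqueness plays no role. -/
theorem posSqrt_spec {C : G →L[ℝ] G} (hC : C.IsPositive) (hc : IsCompactOperator C) :
    (posSqrt C).IsPositive ∧ posSqrt C ∘L posSqrt C = C := by
  have h := exists_isPositive_comp_self_eq hC hc
  rw [posSqrt, dif_pos h]
  exact h.choose_spec

theorem topologicalClosure_range_eq {S : G →L[ℝ] G} (hS : S.IsPositive) :
    S.range.topologicalClosure = S.kerᗮ := by
  rw [ContinuousLinearMap.orthogonal_ker, hS.isSelfAdjoint.adjoint_eq]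

end Sqrt

/-! ### The Moore–Penrose inverse and a criterion for range membership. -/

section Pinv

variable {H K L : Type*}
  [NormedAddCommGroup H] [InnerProductSpace ℝ H] [CompleteSpace H]
  [NormedAddCommGroup K] [InnerProductSpace ℝ K]
  [NormedAddCommGroup L] [InnerProductSpace ℝ L] [CompleteSpace L]

/-- If `ran Y ⊆ ran S`, then `S† Y` is everywhere defined and bounded. -/
theorem exists_clm_eq_pinv_comp (S : H →L[ℝ] K) (Y : L →L[ℝ] K) (hY : Y.range ≤ S.range) :
    ∃ D : L →L[ℝ] H, (D : L →ₗ[ℝ] H).toPMap ⊤ = compCLM (pinv S) Y ∧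
      (∀ v, D v ∈ S.kerᗮ) ∧ S ∘L D = Y := by
  have hdom : ∀ v, Y v ∈ (pinv S).domain := fun v =>
    Submodule.mem_sup_left (hY ⟨v, rfl⟩)
  let D₀ : L →ₗ[ℝ] H := (pinv S).toFun ∘ₗ (Y : L →ₗ[ℝ] K).codRestrict (pinv S).domain hdom
  have hD₀ : ∀ v, D₀ v = pinv S ⟨Y v, hdom v⟩ := fun v => rfl
  have hmem : ∀ v, D₀ v ∈ S.kerᗮ := fun v => (pinv_spec S ⟨Y v, hdom v⟩).1
  have hSD : ∀ v, S (D₀ v) = Y v := fun v => by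
    have h1 := (pinv_spec S ⟨Y v, hdom v⟩).2
    have h2 : Y v - S (D₀ v) ∈ S.range := Submodule.sub_mem _ (hY ⟨v, rfl⟩) ⟨D₀ v, rfl⟩
    exact (sub_eq_zero.1 (inner_self_eq_zero.1
      (Submodule.inner_right_of_mem_orthogonal h2 h1))).symm
  -- Closed graph theorem: limits stay in the closed subspace `(ker S)ᗮ`, on which `S` is injective.
  have hcont : Continuous D₀ := by
    refine LinearMap.continuous_of_seq_closed_graph D₀ fun u v w hu hw => ?_
    refine eq_of_mem_ker_orthogonal ?_ (hmem v) ?_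
    · exact (Submodule.isClosed_orthogonal _).mem_of_tendsto hw
        (Filter.Eventually.of_forall fun n => hmem (u n))
    · rw [hSD]
      refine tendsto_nhds_unique ((S.continuous.tendsto _).comp hw)
        (((Y.continuous.tendsto _).comp hu).congr fun n => ?_)
      exact (hSD (u n)).symm
  refine ⟨⟨D₀, hcont⟩, ?_, hmem, ContinuousLinearMap.ext hSD⟩
  refine LinearPMap.ext ?_ fun v _ _ => rfl
  ext v
  exact ⟨fun _ => hdom v, fun _ => trivial⟩

/-- A vector `k` with `2 ⟪k, a⟫ ≤ q + ‖S a‖²` for all `a` lies in the range of `S`. -/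
theorem mem_range_of_inner_le {G : Type*} [NormedAddCommGroup G] [InnerProductSpace ℝ G]
    [CompleteSpace G] {S : G →L[ℝ] G} (hS : S.IsPositive) {k : G} {q : ℝ}
    (h : ∀ a, 2 * ⟪k, a⟫_ℝ ≤ q + ‖S a‖ ^ 2) : k ∈ S.range := by
  have hq : 0 ≤ q := by simpa using h 0
  have h1 : ∀ a, |⟪k, a⟫_ℝ| ≤ Real.sqrt q * ‖S a‖ := fun a => by
    -- Replacing `a` by `t • a` gives a quadratic in `t` that is nonnegative everywhere, so its
    -- discriminant yields a Cauchy–Schwarz bound.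
    have h2 := discrim_le_zero (a := ‖S a‖ ^ 2) (b := -(2 * ⟪k, a⟫_ℝ)) (c := q) fun t => by
      have := h (t • a)
      rw [inner_smul_right, map_smul, norm_smul, mul_pow, Real.norm_eq_abs, sq_abs] at this
      linarith
    refine abs_le_of_sq_le_sq ?_ (by positivity)
    rw [mul_pow, Real.sq_sqrt hq]
    rw [discrim] at h2
    linarith
  -- The section `s` is merely linear, but `h1` makes `S a ↦ ⟪k, a⟫` bounded and independent of the
  -- preimage. Hahn–Banach and Riesz then represent it by a vector, whose image under `S` is `k`.
  obtain ⟨s, hs⟩ := (S : G →ₗ[ℝ] G).rangeRestrict.exists_rightInverse_of_surjective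
    (S : G →ₗ[ℝ] G).range_rangeRestrict
  have hs' : ∀ v : S.range, S (s v) = v := fun v =>
    congrArg Subtype.val (LinearMap.congr_fun hs v)
  let ℓ : StrongDual ℝ S.range := LinearMap.mkContinuous
    ((innerSL ℝ k : G →ₗ[ℝ] ℝ) ∘ₗ s) (Real.sqrt q) fun v => by
      have := h1 (s v)
      rw [hs'] at this
      simpa using this
  obtain ⟨g, hg, -⟩ := exists_extension_norm_eq S.range ℓ
  refine ⟨(toDual ℝ G).symm g, ext_inner_right ℝ fun a => ?_⟩
  have h3 : ⟪k, s ⟨S a, ⟨a, rfl⟩⟩⟫_ℝ = ⟪k, a⟫_ℝ := by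
    have h4 := h1 (s ⟨S a, ⟨a, rfl⟩⟩ - a)
    rw [map_sub, hs', sub_self, norm_zero, mul_zero, inner_sub_right] at h4
    exact sub_eq_zero.1 (abs_nonpos_iff.1 h4)
  calc ⟪S ((toDual ℝ G).symm g), a⟫_ℝ = g (S a) := by
        rw [hS.inner_left_eq_inner_right, toDual_symm_apply]
    _ = ℓ ⟨S a, ⟨a, rfl⟩⟩ := hg ⟨S a, ⟨a, rfl⟩⟩
    _ = ⟪k, a⟫_ℝ := h3

end Pinv

/-! ### Covariances and the mean squared error. -/

section

/-- Orthonormal vectors lie at distance `√2`, so the balls of radius `1/2` around them are disjoint.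
Countability of the basis permits exchanging sum and integral below. -/
theorem countable_of_orthonormal {ι E : Type*} [NormedAddCommGroup E] [InnerProductSpace ℝ E]
    [TopologicalSpace.SeparableSpace E] {e : ι → E} (he : Orthonormal ℝ e) : Countable ι := by
  refine Pairwise.countable_of_isOpen_disjoint (s := fun i => Metric.ball (e i) (1 / 2)) ?_
    (fun _ => Metric.isOpen_ball) fun i => ⟨e i, Metric.mem_ball_self (by norm_num)⟩
  intro i j hij
  refine Metric.ball_disjoint_ball ?_
  have h1 : dist (e i) (e j) ^ 2 = 2 := by
    rw [dist_eq_norm, norm_sub_sq_real, he.1, he.1, he.2 hij]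
    norm_num
  have h2 : (0 : ℝ) ≤ dist (e i) (e j) := dist_nonneg
  nlinarith

variable {Ω ι F G : Type*} [MeasurableSpace Ω] {P : Measure Ω}
  [NormedAddCommGroup F] [InnerProductSpace ℝ F]
  [NormedAddCommGroup G] [InnerProductSpace ℝ G] [CompleteSpace G]
  {x : Ω → F} {y : Ω → G}

theorem hasSum_integral_inner_sq [Countable ι] (b : HilbertBasis ι ℝ F) (hx : MemLp x 2 P) :
    HasSum (fun i => ∫ ω, ⟪b i, x ω⟫_ℝ ^ 2 ∂P) (∫ ω, ‖x ω‖ ^ 2 ∂P) := by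
  have h1 : ∀ ω, HasSum (fun i => ⟪b i, x ω⟫_ℝ ^ 2) (‖x ω‖ ^ 2) := fun ω => by
    simpa only [real_inner_comm] using hasSum_inner_sq b (x ω)
  refine hasSum_integral_of_dominated_convergence (fun i ω => ⟪b i, x ω⟫_ℝ ^ 2)
    (fun i => (hx.const_inner (b i)).integrable_sq.aestronglyMeasurable)
    (fun i => Filter.Eventually.of_forall fun ω => ?_)
    (Filter.Eventually.of_forall fun ω => (h1 ω).summable) ?_
    (Filter.Eventually.of_forall h1)
  · rw [Real.norm_of_nonneg (sq_nonneg _)]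
  · simp only [fun ω => (h1 ω).tsum_eq]
    exact hx.integrable_norm_pow (by norm_num)

/-- The mean squared error in the direction `u`, in terms of covariances. -/
theorem integral_inner_sub_inner_sq (hx : MemLp x 2 P) (hy : MemLp y 2 P) (u : F) (a : G) :
    ∫ ω, (⟪u, x ω⟫_ℝ - ⟪a, y ω⟫_ℝ) ^ 2 ∂P = ∫ ω, ⟪u, x ω⟫_ℝ ^ 2 ∂P -
      2 * ⟪crossCov P y x u, a⟫_ℝ + ⟪crossCov P y y a, a⟫_ℝ := by
  have hu := hx.const_inner (𝕜 := ℝ) u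
  have ha := hy.const_inner (𝕜 := ℝ) a
  have ha' := hy.inner_const (𝕜 := ℝ) a
  rw [inner_crossCov hy hx, inner_crossCov hy hy, ← integral_const_mul, ← integral_sub,
    ← integral_add]
  · refine integral_congr_ae (Filter.Eventually.of_forall fun ω => ?_)
    simp only [real_inner_comm]
    ring
  · exact hu.integrable_sq.sub ((ha'.integrable_mul hu).const_mul 2)
  · exact ha'.integrable_mul ha
  · exact hu.integrable_sq
  · exact (ha'.integrable_mul hu).const_mul 2

theorem isPositive_crossCov_self (hy : MemLp y 2 P) : (crossCov P y y).IsPositive := by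
  refine (ContinuousLinearMap.isPositive_iff _).2 ⟨fun v w => ?_, fun v => ?_⟩
  · rw [ContinuousLinearMap.coe_coe, inner_crossCov hy hy, real_inner_comm, inner_crossCov hy hy]
    refine integral_congr_ae (Filter.Eventually.of_forall fun ω => ?_)
    simp only [real_inner_comm]
    ring
  · rw [inner_crossCov hy hy]
    refine integral_nonneg fun ω => ?_
    rw [real_inner_comm]
    exact mul_self_nonneg _

/-- The integrand takes rank-one values, and the compact operators form a closed convex set, which
contains averages over a probability measure. -/
theorem isCompactOperator_crossCov [IsProbabilityMeasure P] (hx : MemLp x 2 P)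
    (hy : MemLp y 2 P) : IsCompactOperator (crossCov P y x) := by
  refine Convex.integral_mem (s := (compactOperator (RingHom.id ℝ) F G : Set (F →L[ℝ] G)))
    (compactOperator (RingHom.id ℝ) F G).convex isClosed_setOfPred_isCompactOperator
    (Filter.Eventually.of_forall fun ω => ?_) (integrable_rankOne hy hx)
  have := sum_rankOne_mem_rankLE 1 (fun _ => y ω) (fun _ => x ω)
  rw [Finset.sum_range_one] at this
  exact isCompactOperator_of_mem_rankLE this

variable {S : G →L[ℝ] G}

theorem range_crossCov_le (hx : MemLp x 2 P) (hy : MemLp y 2 P) (hS : S.IsPositive)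
    (hSC : S ∘L S = crossCov P y y) : (crossCov P y x).range ≤ S.range := by
  rintro _ ⟨u, rfl⟩
  refine mem_range_of_inner_le hS (q := ∫ ω, ⟪u, x ω⟫_ℝ ^ 2 ∂P) fun a => ?_
  have h1 := integral_inner_sub_inner_sq hx hy u a
  rw [inner_apply_self_of_comp_self_eq hS hSC] at h1
  have h2 : 0 ≤ ∫ ω, (⟪u, x ω⟫_ℝ - ⟪a, y ω⟫_ℝ) ^ 2 ∂P := integral_nonneg fun _ => sq_nonneg _
  rw [ContinuousLinearMap.coe_coe]
  linarith

variable {M : F →L[ℝ] G}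

/-- Nonnegativity of the error gives `2⟪M u, w⟫ ≤ q + ‖w‖²` for `w` in `ran S`, hence on its
closure, which contains `M u`; then take `w = M u`. -/
theorem norm_sq_apply_le_integral (hx : MemLp x 2 P) (hy : MemLp y 2 P) (hS : S.IsPositive)
    (hSC : S ∘L S = crossCov P y y) (hM : ∀ u, M u ∈ S.kerᗮ) (hSM : S ∘L M = crossCov P y x)
    (u : F) : ‖M u‖ ^ 2 ≤ ∫ ω, ⟪u, x ω⟫_ℝ ^ 2 ∂P := by
  set q := ∫ ω, ⟪u, x ω⟫_ℝ ^ 2 ∂P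
  have h1 : ∀ w ∈ closure (S.range : Set G), 2 * ⟪M u, w⟫_ℝ ≤ q + ‖w‖ ^ 2 := by
    intro w hw
    refine closure_minimal (s := (S.range : Set G)) (t := {w | 2 * ⟪M u, w⟫_ℝ ≤ q + ‖w‖ ^ 2})
      ?_ (isClosed_le (by fun_prop) (by fun_prop)) hw
    rintro _ ⟨a, rfl⟩
    have h2 := integral_inner_sub_inner_sq hx hy u a
    rw [inner_apply_self_of_comp_self_eq hS hSC, ← hSM, ContinuousLinearMap.comp_apply,
      hS.inner_left_eq_inner_right] at h2
    have h3 : 0 ≤ ∫ ω, (⟪u, x ω⟫_ℝ - ⟪a, y ω⟫_ℝ) ^ 2 ∂P := integral_nonneg fun _ => sq_nonneg _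
    show 2 * ⟪M u, S a⟫_ℝ ≤ q + ‖S a‖ ^ 2
    linarith
  have h4 := h1 (M u) (by
    rw [← Submodule.topologicalClosure_coe, topologicalClosure_range_eq hS]
    exact hM u)
  rw [real_inner_self_eq_norm_sq] at h4
  linarith

theorem isHS_of_comp_eq_crossCov [Countable ι] (b : HilbertBasis ι ℝ F) (hx : MemLp x 2 P)
    (hy : MemLp y 2 P) (hS : S.IsPositive) (hSC : S ∘L S = crossCov P y y)
    (hM : ∀ u, M u ∈ S.kerᗮ) (hSM : S ∘L M = crossCov P y x) : IsHS b M :=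
  Summable.of_nonneg_of_le (fun _ => sq_nonneg _)
    (fun i => norm_sq_apply_le_integral hx hy hS hSC hM hSM (b i))
    (hasSum_integral_inner_sq b hx).summable

variable [CompleteSpace F]

/-- Up to a constant, the mean squared error of `A` is the squared Hilbert--Schmidt distance of
`S A*` and `M`. -/
theorem integral_norm_sub_sq_eq [Countable ι] (b : HilbertBasis ι ℝ F) (hx : MemLp x 2 P)
    (hy : MemLp y 2 P) (hS : S.IsPositive) (hSC : S ∘L S = crossCov P y y)
    (hSM : S ∘L M = crossCov P y x) (hM : IsHS b M) (A : G →L[ℝ] F) :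
    ∫ ω, ‖x ω - A (y ω)‖ ^ 2 ∂P =
      (∫ ω, ‖x ω‖ ^ 2 ∂P - hsSq b M) + hsSq b (M - S ∘L A.adjoint) := by
  have h1 := hasSum_integral_inner_sq b (hx.sub (A.comp_memLp' hy))
  have h2 : ∀ i, ∫ ω, ⟪b i, (x - A ∘ y) ω⟫_ℝ ^ 2 ∂P =
      (∫ ω, ⟪b i, x ω⟫_ℝ ^ 2 ∂P - ‖M (b i)‖ ^ 2) + ‖(M - S ∘L A.adjoint) (b i)‖ ^ 2 := fun i => by
    have h3 := integral_inner_sub_inner_sq hx hy (b i) (A.adjoint (b i))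
    rw [inner_apply_self_of_comp_self_eq hS hSC, ← hSM, ContinuousLinearMap.comp_apply,
      hS.inner_left_eq_inner_right] at h3
    simp only [ContinuousLinearMap.adjoint_inner_left, ← inner_sub_right] at h3
    rw [sub_apply, ContinuousLinearMap.comp_apply, norm_sub_sq_real]
    simp only [Pi.sub_apply, Function.comp_apply]
    rw [h3]
    ring
  simp only [h2] at h1
  have h4 := (hasSum_integral_inner_sq b hx).sub hM.hasSum
  have h5 := h1.sub h4
  simp only [add_sub_cancel_left] at h5
  have h6 : hsSq b (M - S ∘L A.adjoint) = _ := h5.tsum_eq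
  rw [h6]
  simp

end

/-! ### From predictors `A` to approximations `S A*` of `M`. -/

section

variable {ι F G : Type*}
  [NormedAddCommGroup F] [InnerProductSpace ℝ F] [CompleteSpace F]
  [NormedAddCommGroup G] [InnerProductSpace ℝ G] [CompleteSpace G]

theorem adjoint_mem_rankLE {r : ℕ} {A : F →L[ℝ] G} (hA : A ∈ rankLE (L := F) (K := G) r) :
    A.adjoint ∈ rankLE (L := G) (K := F) r := by
  obtain ⟨σ, e, f, h, -⟩ := exists_svdSystem (isCompactOperator_of_mem_rankLE hA)
  rw [h.eq_svdSum_of_mem_rankLE hA, adjoint_svdSum]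
  exact svdSum_mem_rankLE r

/-- Injectivity of `S` on `(ker S)ᗮ` lifts the SVD expansion of `S D` to an expansion of `D` along
the same right singular vectors. -/
theorem mem_rankLE_of_comp_mem {r : ℕ} {S : G →L[ℝ] G} {D : F →L[ℝ] G}
    (hD : ∀ u, D u ∈ S.kerᗮ) (hSD : S ∘L D ∈ rankLE (L := F) (K := G) r) :
    D ∈ rankLE (L := F) (K := G) r := by
  obtain ⟨σ, e, f, h, -⟩ := exists_svdSystem (isCompactOperator_of_mem_rankLE hSD)
  have h1 : D = ∑ i ∈ Finset.range r, rankOne ℝ (D (e i)) (e i) := by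
    ext u
    simp only [sum_apply, rankOne_apply]
    refine eq_of_mem_ker_orthogonal (hD u)
      (Submodule.sum_mem _ fun i _ => Submodule.smul_mem _ _ (hD _)) ?_
    have h2 := DFunLike.congr_fun (h.eq_svdSum_of_mem_rankLE hSD) u
    rw [svdSum_apply, ContinuousLinearMap.comp_apply] at h2
    rw [h2, map_sum]
    refine Finset.sum_congr rfl fun i _ => ?_
    rw [map_smul, ← ContinuousLinearMap.comp_apply, h.apply_right, smul_smul, mul_comm]
  rw [h1]
  exact sum_rankOne_mem_rankLE r _ _

theorem comp_starProjection_eq_self_iff {U : Submodule ℝ G} [U.HasOrthogonalProjection] {A : G →L[ℝ] F} :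
    A ∘L U.starProjection = A ↔ ∀ u, A.adjoint u ∈ U := by
  constructor
  · intro h u
    rw [← Submodule.starProjection_eq_self_iff]
    refine ext_inner_right ℝ fun v => ?_
    rw [Submodule.inner_starProjection_left_eq_right, ContinuousLinearMap.adjoint_inner_left,
      ContinuousLinearMap.adjoint_inner_left]
    exact congrArg _ (DFunLike.congr_fun h v)
  · intro h
    ext v
    refine ext_inner_left ℝ fun u => ?_
    rw [ContinuousLinearMap.comp_apply, ← ContinuousLinearMap.adjoint_inner_left,
      ← Submodule.inner_starProjection_left_eq_right,
      Submodule.starProjection_eq_self_iff.2 (h u), ContinuousLinearMap.adjoint_inner_left]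

variable {b : HilbertBasis ι ℝ F} {S : G →L[ℝ] G} {M : F →L[ℝ] G}

/-- An operator `S A*` which is the best approximation of `M` among all `S B*` is also the best
approximation among all operators of the same rank, as `ran S` is dense in `(ker S)ᗮ`. -/
theorem hsSq_sub_le_of_forall_comp_adjoint (hS : S.IsPositive) (hM : IsHS b M)
    (hMker : ∀ u, M u ∈ S.kerᗮ) {r : ℕ} {c : ℝ}
    (hc : ∀ B ∈ rankLE (L := G) (K := F) r, c ≤ hsSq b (M - S ∘L B.adjoint))
    {B' : F →L[ℝ] G} (hB' : B' ∈ rankLE (L := F) (K := G) r) : c ≤ hsSq b (M - B') := by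
  obtain ⟨σ, e, f, h, -⟩ := exists_svdSystem (isCompactOperator_of_mem_rankLE hB')
  -- Projecting the left factors of `B'` onto `(ker S)ᗮ` does not increase the error, as `M` takes
  -- values there. The projected factors are limits of tuples in `ran S`, which come from admissible
  -- competitors, and the error is continuous in the factors.
  set d : ℕ → G := fun i => S.kerᗮ.starProjection (σ i • f i) with hd
  have h1 : ∀ u ∈ Set.pi Set.univ (fun _ : ℕ => (S.range : Set G)),
      c ≤ hsSq b (M - ∑ i ∈ Finset.range r, rankOne ℝ (u i) (e i)) := by
    intro u hu
    choose a ha using fun i => hu i (Set.mem_univ i)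
    have h2 := hc _ (sum_rankOne_mem_rankLE r e a)
    convert h2 using 3
    rw [map_sum, ContinuousLinearMap.comp_finsetSum]
    refine Finset.sum_congr rfl fun i _ => ?_
    rw [adjoint_rankOne, comp_rankOne]
    exact congrArg (fun z => rankOne ℝ z (e i)) (ha i).symm
  have h3 : c ≤ hsSq b (M - ∑ i ∈ Finset.range r, rankOne ℝ (d i) (e i)) := by
    have hcont := continuous_hsSq_sub_sum_rankOne hM (Finset.range r) e
    refine closure_minimal (t := {u : ℕ → G |
      c ≤ hsSq b (M - ∑ i ∈ Finset.range r, rankOne ℝ (u i) (e i))}) h1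
      (isClosed_le continuous_const hcont) ?_
    rw [closure_pi_set]
    intro i _
    rw [← Submodule.topologicalClosure_coe, topologicalClosure_range_eq hS]
    exact Submodule.starProjection_apply_mem _ _
  refine h3.trans (hasSum_le (fun i => ?_)
    (hM.sub_sum_rankOne (Finset.range r) d e).hasSum (hM.sub_of_mem_rankLE hB').hasSum)
  have h4 : (M - ∑ i ∈ Finset.range r, rankOne ℝ (d i) (e i)) (b i) =
      S.kerᗮ.starProjection ((M - B') (b i)) := by
    rw [sub_apply, sub_apply, map_sub, Submodule.starProjection_eq_self_iff.2 (hMker _),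
      h.eq_svdSum_of_mem_rankLE hB', svdSum_apply, map_sum, sum_apply]
    congr 1
    refine Finset.sum_congr rfl fun j _ => ?_
    rw [rankOne_apply, hd, mul_comm, mul_smul, map_smul]
  rw [h4]
  exact pow_le_pow_left₀ (norm_nonneg _) (Submodule.norm_starProjection_apply_le _ _) 2

theorem forall_hsSq_le_iff_isTruncatedSVD (hS : S.IsPositive) (hM : IsHS b M)
    (hMker : ∀ u, M u ∈ S.kerᗮ) {r : ℕ} {A : G →L[ℝ] F} :
    (A ∈ rankLE (L := G) (K := F) r ∧ ∀ B ∈ rankLE (L := G) (K := F) r,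
      hsSq b (M - S ∘L A.adjoint) ≤ hsSq b (M - S ∘L B.adjoint)) ↔
    A ∈ rankLE (L := G) (K := F) r ∧ IsTruncatedSVD r M (S ∘L A.adjoint) := by
  have hrank : ∀ B ∈ rankLE (L := G) (K := F) r, S ∘L B.adjoint ∈ rankLE (L := F) (K := G) r :=
    fun B hB => (LinearMap.rank_comp_le_right _ _).trans (adjoint_mem_rankLE hB)
  refine and_congr_right fun hA => ⟨fun h => ?_, fun h B hB => ?_⟩
  · exact isTruncatedSVD_of_forall_hsSq_le hM (hrank A hA) fun B' hB' =>
      hsSq_sub_le_of_forall_comp_adjoint hS hM hMker h hB'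
  · obtain ⟨σ, e, f, hsys, hY⟩ := isTruncatedSVD_iff.1 h
    rw [hY]
    exact hsys.hsSq_sub_svdSum_le hM (hrank B hB)

end

end RankLearning

/-! ### Assembly of the theorem. -/

open RankLearning in
theorem mainTheorem10
    {Ω F G : Type*} [MeasurableSpace Ω] (P : Measure Ω) [IsProbabilityMeasure P]
    [NormedAddCommGroup F] [InnerProductSpace ℝ F] [CompleteSpace F]
    [TopologicalSpace.SeparableSpace F]
    [NormedAddCommGroup G] [InnerProductSpace ℝ G] [CompleteSpace G]
    [TopologicalSpace.SeparableSpace G]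
    (x : Ω → F) (y : Ω → G) (hx : MemLp x 2 P) (hy : MemLp y 2 P) (r : ℕ)
    (Cy S : G →L[ℝ] G) (Cyx : F →L[ℝ] G)
    (hCy : Cy = crossCov P y y) (hS : S = posSqrt Cy) (hCyx : Cyx = crossCov P y x) :
    ∃ M : F →L[ℝ] G,
      -- `M = (C_y^{1/2})† C_{yx}`, which is defined everywhere, bounded and compact
      (M : F →ₗ[ℝ] G).toPMap ⊤ = compCLM (pinv S) Cyx ∧ IsCompactOperator M ∧
      -- existence
      ((∃ A : G →L[ℝ] F, IsSolution P x y r A) ↔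
        ∃ Y : F →L[ℝ] G, IsTruncatedSVD r M Y ∧ Y.range ≤ S.range) ∧
      -- every admissible truncated SVD gives a solution
      (∀ Y : F →L[ℝ] G,
        IsTruncatedSVD r (S.range.topologicalClosure.starProjection ∘L M) Y →
        Y.range ≤ S.range →
        ∃ A : G →L[ℝ] F,
          (A : G →ₗ[ℝ] F).toPMap ⊤ = (compCLM (pinv S) Y).adjoint ∧
          IsSolution P x y r A ∧
          A ∘L Cy.kerᗮ.starProjection = A ∧
          -- uniqueness
          ((∀ A' : G →L[ℝ] F, IsSolution P x y r A' → A' ∘L Cy.kerᗮ.starProjection = A' → A' = A) ↔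
            ∀ Y' : F →L[ℝ] G,
              IsTruncatedSVD r (S.range.topologicalClosure.starProjection ∘L M) Y' →
              Y'.range ≤ S.range → Y' = Y) ∧
          -- in particular, uniqueness if `(P M)_r` is unique among all truncated SVDs
          ((∀ Y' : F →L[ℝ] G,
              IsTruncatedSVD r (S.range.topologicalClosure.starProjection ∘L M) Y' → Y' = Y) →
            ∀ A' : G →L[ℝ] F, IsSolution P x y r A' →
              A' ∘L Cy.kerᗮ.starProjection = A' → A' = A)) := by
  have hCpos : Cy.IsPositive := hCy ▸ isPositive_crossCov_self hy
  have hCc : IsCompactOperator Cy := hCy ▸ isCompactOperator_crossCov hy hy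
  obtain ⟨hSpos, hSC⟩ := hS ▸ posSqrt_spec hCpos hCc
  have hker : Cy.ker = S.ker := ker_eq_of_comp_self_eq hSpos hSC
  have hcl : S.range.topologicalClosure = S.kerᗮ := topologicalClosure_range_eq hSpos
  subst hCy hCyx
  obtain ⟨M, hMpinv, hMker, hSM⟩ :=
    exists_clm_eq_pinv_comp S (crossCov P y x) (range_crossCov_le hx hy hSpos hSC)
  obtain ⟨w, b, -⟩ := exists_hilbertBasis ℝ F
  have : Countable w := countable_of_orthonormal b.orthonormal
  have hHS : IsHS b M := isHS_of_comp_eq_crossCov b hx hy hSpos hSC hMker hSM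
  have hsol : ∀ A : G →L[ℝ] F, IsSolution P x y r A ↔
      A ∈ rankLE (L := G) (K := F) r ∧ IsTruncatedSVD r M (S ∘L A.adjoint) := fun A => by
    rw [← forall_hsSq_le_iff_isTruncatedSVD hSpos hHS hMker, IsSolution, isMinOn_iff]
    simp only [integral_norm_sub_sq_eq b hx hy hSpos hSC hSM hHS, add_le_add_iff_left]
  -- The projection acts trivially because `M` already maps into the closure of `ran S`, so the same
  -- truncated SVDs govern all three claims.
  have hPM : S.range.topologicalClosure.starProjection ∘L M = M := by
    ext u
    exact Submodule.starProjection_eq_self_iff.2 (hcl ▸ hMker u)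
  -- the solution belonging to an admissible truncation
  have hex : ∀ Y : F →L[ℝ] G, IsTruncatedSVD r M Y → Y.range ≤ S.range →
      ∃ D : F →L[ℝ] G, (D : F →ₗ[ℝ] G).toPMap ⊤ = compCLM (pinv S) Y ∧ (∀ u, D u ∈ S.kerᗮ) ∧
        S ∘L D = Y ∧ IsSolution P x y r D.adjoint := fun Y hY hYS => by
    obtain ⟨D, hD, hDker, hSD⟩ := exists_clm_eq_pinv_comp S Y hYS
    refine ⟨D, hD, hDker, hSD, (hsol _).2 ⟨?_, ?_⟩⟩
    · refine adjoint_mem_rankLE (mem_rankLE_of_comp_mem hDker ?_)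
      obtain ⟨σ, e, f, -, rfl⟩ := isTruncatedSVD_iff.1 hY
      exact hSD ▸ svdSum_mem_rankLE r
    · rwa [ContinuousLinearMap.adjoint_adjoint, hSD]
  have hproj : ∀ A : G →L[ℝ] F, A ∘L (crossCov P y y).kerᗮ.starProjection = A ↔
      ∀ u, A.adjoint u ∈ S.kerᗮ := fun A =>
    comp_starProjection_eq_self_iff.trans (by rw [hker])
  have hrange : ∀ A : G →L[ℝ] F, (S ∘L A.adjoint).range ≤ S.range := fun A => by
    rintro _ ⟨u, rfl⟩
    exact ⟨A.adjoint u, rfl⟩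
  refine ⟨M, hMpinv, hHS.isCompactOperator, ⟨?_, ?_⟩, ?_⟩
  · rintro ⟨A, hA⟩
    exact ⟨S ∘L A.adjoint, ((hsol A).1 hA).2, hrange A⟩
  · rintro ⟨Y, hY, hYS⟩
    obtain ⟨D, -, -, -, hD⟩ := hex Y hY hYS
    exact ⟨_, hD⟩
  rw [hPM]
  intro Y hY hYS
  obtain ⟨D, hDpinv, hDker, hSD, hDsol⟩ := hex Y hY hYS
  have huniq : (∀ Y' : F →L[ℝ] G, IsTruncatedSVD r M Y' → Y'.range ≤ S.range → Y' = Y) →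
      ∀ A' : G →L[ℝ] F, IsSolution P x y r A' →
        A' ∘L (crossCov P y y).kerᗮ.starProjection = A' → A' = D.adjoint := by
    intro h A' hA' hA'P
    have h1 := h _ ((hsol A').1 hA').2 (hrange A')
    have h2 : A'.adjoint = D := by
      ext u
      refine eq_of_mem_ker_orthogonal ((hproj A').1 hA'P u) (hDker u) ?_
      exact DFunLike.congr_fun (h1.trans hSD.symm) u
    rw [← h2, ContinuousLinearMap.adjoint_adjoint]
  refine ⟨D.adjoint, ?_, hDsol, ?_, ⟨fun h Y' hY' hY'S => ?_, huniq⟩,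
    fun h => huniq fun Y' hY' _ => h Y' hY'⟩
  -- The adjoint of `S† Y` is taken as that of a partially defined operator; it is single-valued
  -- because the domain is everything, hence dense.
  · rw [← hDpinv, ContinuousLinearMap.toPMap_adjoint_eq_adjoint_toPMap_of_dense]
    exact dense_univ
  · rw [hproj, ContinuousLinearMap.adjoint_adjoint]
    exact hDker
  · obtain ⟨D', -, hD'ker, hSD', hD'sol⟩ := hex Y' hY' hY'S
    have h1 := h _ hD'sol (by
      rw [hproj, ContinuousLinearMap.adjoint_adjoint]
      exact hD'ker)
    rw [← hSD', ← hSD, ContinuousLinearMap.adjoint.injective h1]
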